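/- Every nonsingular integer $n\times n$ matrix $A$ can be written $A=U\,\mathrm{diag}(s_1(A),\dots,s_n(A))\,V$ with integer matrices $U,V$ of determinant $\pm1$ and nonnegative integers $s_i(A)$ such that $s_i(A)\mid s_{i+1}(A)$; the $s_i(A)$ are the invariant factors of $A$ (the same definition is used for singular square integer matrices, where some $s_i$ are $0$). Write $\mu_k=s_1s_2\cdots s_k$ for the product of the $k$ smallest and $\pi_k=s_{n-k+1}\cdots s_n$ for the product of the $k$ biggest invariant factors. Let $\|A\|$ be the largest absolute value of an entry of $A$ and let $H=(\sqrt n\,\|A\|)^n$ be the Hadamard bound for $A$. There are absolute constants $C_1,C_2$ such that the following holds. Let $2\le k\le n$, let $A$ be an $n\times n$ integer matrix with $\det A\neq0$, and let $\mathcal S=\{a,a+1,\dots,a+S-1\}$ be a set of $S\ge1$ contiguous integers. Then $M=s_n(A)A^{-1}$ is an integer matrix, and if $B_1,B_2$ are random $n\times k$ matrices and $R_1,R_2$ random $k\times n$ matrices all of whose entries are chosen independently and uniformly from $\mathcal S$, then $$\left|\,\mathbf E\left(\log\left(\frac{\pi_k(A)}{s_n(A)^k}\gcd\bigl(\mu_k(R_1MB_1),\mu_k(R_2MB_2),s_n(A)^k\bigr)\right)\right)\right|\le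 C_1+C_2\,\frac{k^3\log^4 H}{S}.$$ In other words, the expectation is $O(1)+O\!\left(\frac{k^3\log^4 H}{S}\right)$, with constants that do not depend on $n,k,A,a,S$; in particular it is $O(1)$ when $S\ge k^3\log^4H$. -/

import Mathlib

open scoped BigOperators

/-- `s` is the list of diagonal entries of the Smith form of the square integer matrix `A`:
`A = U * diag(s) * V` with `U`, `V` integer matrices of determinant `±1`, the entries of `s` are
nonnegative, and each of them divides the following ones. -/
def IsSmithForm {n : ℕ} (A : Matrix (Fin n) (Fin n) ℤ) (s : Fin n → ℕ) : Prop :=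
  (∀ i j, i ≤ j → s i ∣ s j) ∧
    ∃ U V : Matrix (Fin n) (Fin n) ℤ, IsUnit U.det ∧ IsUnit V.det ∧
      A = U * Matrix.diagonal (fun i => (s i : ℤ)) * V

/-- `B` is obtained from `A` by unimodular row and column transformations. -/
def UnimodularEquiv {n : ℕ} (A B : Matrix (Fin n) (Fin n) ℤ) : Prop :=
  ∃ P Q : Matrix (Fin n) (Fin n) ℤ, IsUnit P.det ∧ IsUnit Q.det ∧ B = P * A * Q

namespace UnimodularEquiv

variable {n : ℕ} {A B C : Matrix (Fin n) (Fin n) ℤ}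

theorem refl (A : Matrix (Fin n) (Fin n) ℤ) : UnimodularEquiv A A :=
  ⟨1, 1, by simp, by simp, by simp⟩

theorem trans (h₁ : UnimodularEquiv A B) (h₂ : UnimodularEquiv B C) : UnimodularEquiv A C := by
  obtain ⟨P, Q, hP, hQ, rfl⟩ := h₁
  obtain ⟨P', Q', hP', hQ', rfl⟩ := h₂
  refine ⟨P' * P, Q * Q', ?_, ?_, ?_⟩
  · rw [Matrix.det_mul]; exact hP'.mul hP
  · rw [Matrix.det_mul]; exact hQ.mul hQ'
  · simp only [Matrix.mul_assoc]

theorem symm (h : UnimodularEquiv A B) : UnimodularEquiv B A := by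
  obtain ⟨P, Q, hP, hQ, rfl⟩ := h
  refine ⟨P⁻¹, Q⁻¹, ?_, ?_, ?_⟩
  · exact Matrix.isUnit_nonsing_inv_det P hP
  · exact Matrix.isUnit_nonsing_inv_det Q hQ
  · rw [Matrix.mul_assoc P, Matrix.nonsing_inv_mul_cancel_left _ _ hP,
      Matrix.mul_nonsing_inv_cancel_right _ _ hQ]

theorem transpose (h : UnimodularEquiv A B) : UnimodularEquiv A.transpose B.transpose := by
  obtain ⟨P, Q, hP, hQ, rfl⟩ := h
  exact ⟨Q.transpose, P.transpose, by simpa using hQ, by simpa using hP,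
    by simp [Matrix.transpose_mul, Matrix.mul_assoc]⟩

theorem addRow (A : Matrix (Fin n) (Fin n) ℤ) {i j : Fin n} (h : i ≠ j) (c : ℤ) :
    UnimodularEquiv A (Matrix.transvection i j c * A) :=
  ⟨Matrix.transvection i j c, 1, by simp [Matrix.det_transvection_of_ne _ _ h], by simp, by simp⟩

theorem perm (A : Matrix (Fin n) (Fin n) ℤ) (e f : Equiv.Perm (Fin n)) :
    UnimodularEquiv A (A.submatrix e f) := by
  refine ⟨e.permMatrix ℤ, (f⁻¹).permMatrix ℤ, ?_, ?_, ?_⟩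
  · rw [Matrix.det_permutation]; exact Units.isUnit _
  · rw [Matrix.det_permutation]; exact Units.isUnit _
  · ext i j
    simp only [Equiv.Perm.permMatrix, PEquiv.toMatrix_toPEquiv_mul,
      PEquiv.mul_toMatrix_toPEquiv, Matrix.submatrix_apply, id]
    rfl

end UnimodularEquiv

/-- If `d` is the least nonzero absolute value of an entry of a matrix equivalent to `A` and is
attained at the corner of `B`, then it divides the first column of `B`. -/
theorem UnimodularEquiv.dvd_col {n : ℕ} {A B : Matrix (Fin (1 + n)) (Fin (1 + n)) ℤ} {d : ℕ}
    (hmin : ∀ B, UnimodularEquiv A B → ∀ i j, B i j ≠ 0 → d ≤ (B i j).natAbs)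
    (hAB : UnimodularEquiv A B) {z : Fin (1 + n)} (hB : (B z z).natAbs = d) (hd : d ≠ 0)
    (i : Fin (1 + n)) : B z z ∣ B i z := by
  by_cases hi : i = z
  · rw [hi]
  have h := hmin _ (hAB.trans (UnimodularEquiv.addRow B hi (-(B i z / B z z)))) i z
  rw [Matrix.transvection_mul_apply_same] at h
  have hz : B z z ≠ 0 := by
    intro h0; apply hd; rw [← hB, h0]; rfl
  have he : B i z + -(B i z / B z z) * B z z = B i z % B z z := by
    have := Int.emod_add_mul_ediv (B i z) (B z z); linarith
  rw [he] at h
  by_contra hnd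
  have hne : B i z % B z z ≠ 0 := fun h0 => hnd (Int.dvd_of_emod_eq_zero h0)
  have h1 := h hne
  have h2 := Int.emod_nonneg (B i z) hz
  have h3 := Int.emod_lt_abs (B i z) hz
  rw [Int.abs_eq_natAbs] at h3
  omega

/-- The corner entry of such a `B` divides every entry of `B`. -/
theorem UnimodularEquiv.dvd_entry {n : ℕ} {A B : Matrix (Fin (1 + n)) (Fin (1 + n)) ℤ} {d : ℕ}
    (hmin : ∀ B, UnimodularEquiv A B → ∀ i j, B i j ≠ 0 → d ≤ (B i j).natAbs)
    (hAB : UnimodularEquiv A B) {z : Fin (1 + n)} (hB : (B z z).natAbs = d) (hd : d ≠ 0)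
    (i j : Fin (1 + n)) : B z z ∣ B i j := by
  have row : ∀ {B : Matrix (Fin (1 + n)) (Fin (1 + n)) ℤ}, UnimodularEquiv A B →
      (B z z).natAbs = d → ∀ j, B z z ∣ B z j := by
    intro B hAB hB j
    refine UnimodularEquiv.dvd_col (A := A.transpose) (B := B.transpose) (d := d) ?_
      hAB.transpose (z := z) hB hd j
    intro C hC k l hkl
    exact hmin C.transpose (by simpa using hC.transpose) l k hkl
  by_cases hi : i = z
  · rw [hi]; exact row hAB hB j
  obtain ⟨q, hq⟩ := UnimodularEquiv.dvd_col hmin hAB hB hd i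
  have h1 := hAB.trans (UnimodularEquiv.addRow B hi (-q))
  have h2 := h1.trans (UnimodularEquiv.addRow _ (Ne.symm hi) 1)
  have e : ∀ l, (Matrix.transvection z i (1 : ℤ) *
      ((Matrix.transvection i z (-q) * B : Matrix _ _ ℤ)) : Matrix _ _ ℤ) z l =
      B z l + (B i l - q * B z l) := by
    intro l
    rw [Matrix.transvection_mul_apply_same, Matrix.transvection_mul_apply_same,
      Matrix.transvection_mul_apply_of_ne _ _ _ _ (Ne.symm hi)]
    ring
  have ez : (Matrix.transvection z i (1 : ℤ) *
      ((Matrix.transvection i z (-q) * B : Matrix _ _ ℤ)) : Matrix _ _ ℤ) z z = B z z := by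
    rw [e, hq]; ring
  have h3 := row h2 (by rw [ez]; exact hB) j
  rw [ez, e] at h3
  have h4 := row hAB hB j
  have h5 : B i j = (B z j + (B i j - q * B z j)) - (1 - q) * B z j := by ring
  rw [h5]
  exact dvd_sub h3 (h4.mul_left _)

/-- Every square integer matrix has a Smith form. -/
theorem exists_isSmithForm : ∀ {n : ℕ} (A : Matrix (Fin n) (Fin n) ℤ), ∃ s, IsSmithForm A s := by
  intro n
  induction n with
  | zero => exact fun A => ⟨fun _ => 0, fun _ _ _ => dvd_rfl, 1, 1, by simp, by simp,
      Subsingleton.elim _ _⟩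
  | succ n ih =>
    rw [Nat.add_comm n 1]
    intro A
    by_cases hA : A = 0
    · exact ⟨fun _ => 0, fun _ _ _ => dvd_rfl, 1, 1, by simp, by simp, by simp [hA]⟩
    have hex : ∃ d : ℕ, d ≠ 0 ∧ ∃ B, UnimodularEquiv A B ∧ ∃ i j, (B i j).natAbs = d := by
      by_contra hcon
      apply hA
      ext i j
      by_contra h0
      exact hcon ⟨(A i j).natAbs, by simpa using h0, A, UnimodularEquiv.refl A, i, j, rfl⟩
    classical
    obtain ⟨hd, B₀, hB₀, i₀, j₀, hij⟩ := Nat.find_spec hex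
    set d := Nat.find hex with hd_def
    have hmin : ∀ B, UnimodularEquiv A B → ∀ i j, B i j ≠ 0 → d ≤ (B i j).natAbs := by
      intro B hB i j h0
      exact Nat.find_min' hex ⟨by simpa using h0, B, hB, i, j, rfl⟩
    let z : Fin (1 + n) := finSumFinEquiv (Sum.inl (0 : Fin 1))
    let B := B₀.submatrix (Equiv.swap z i₀) (Equiv.swap z j₀)
    have hAB : UnimodularEquiv A B := hB₀.trans (UnimodularEquiv.perm _ _ _)
    have hBz : (B z z).natAbs = d := by simp [B, hij]
    have hdvd := UnimodularEquiv.dvd_entry hmin hAB hBz hd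
    have hz : B z z ≠ 0 := by
      intro h0; apply hd; rw [← hBz, h0]; rfl
    choose C hC using hdvd
    have hCz : C z z = 1 := by
      have := hC z z
      exact (mul_eq_left₀ hz).1 this.symm
    let b : Matrix (Fin 1) (Fin n) ℤ := fun i j => C (finSumFinEquiv (Sum.inl i))
      (finSumFinEquiv (Sum.inr j))
    let c : Matrix (Fin n) (Fin 1) ℤ := fun i j => C (finSumFinEquiv (Sum.inr i))
      (finSumFinEquiv (Sum.inl j))
    let D : Matrix (Fin n) (Fin n) ℤ := fun i j => C (finSumFinEquiv (Sum.inr i))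
      (finSumFinEquiv (Sum.inr j))
    obtain ⟨s, hs, U, V, hU, hV, hUV⟩ := ih (D - c * b)
    let L : Matrix (Fin 1 ⊕ Fin n) (Fin 1 ⊕ Fin n) ℤ := Matrix.fromBlocks 1 0 c U
    let R : Matrix (Fin 1 ⊕ Fin n) (Fin 1 ⊕ Fin n) ℤ := Matrix.fromBlocks 1 b 0 V
    let t : Fin 1 ⊕ Fin n → ℕ := Sum.elim (fun _ => 1) s
    have hfac : (Matrix.of C).submatrix finSumFinEquiv finSumFinEquiv =
        L * Matrix.diagonal (fun i => (t i : ℤ)) * R := by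
      have h1 : Matrix.diagonal (fun i => (t i : ℤ)) =
          Matrix.fromBlocks 1 0 0 (Matrix.diagonal (fun i => (s i : ℤ))) := by
        rw [← Matrix.diagonal_one, Matrix.fromBlocks_diagonal]
        congr 1
        ext i
        rcases i with i | i <;> simp [t]
      have h2 : (Matrix.of C).submatrix finSumFinEquiv finSumFinEquiv =
          Matrix.fromBlocks 1 b c D := by
        ext i j
        rcases i with i | i <;> rcases j with j | j
        · have hi : i = 0 := Subsingleton.elim _ _
          have hj : j = 0 := Subsingleton.elim _ _
          subst hi hj
          exact hCz
        · rfl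
        · rfl
        · rfl
      rw [h1, h2]
      simp only [L, R, Matrix.fromBlocks_multiply]
      simp only [Matrix.one_mul, Matrix.mul_one, Matrix.zero_mul, Matrix.mul_zero, add_zero,
        zero_add, ← hUV]
      congr 1
      abel
    obtain ⟨u, hu⟩ : ∃ u : ℤˣ, B z z = u * (d : ℤ) := by
      rw [← hBz]
      rcases Int.natAbs_eq (B z z) with h | h
      · exact ⟨1, by simpa using h⟩
      · exact ⟨-1, by simpa using h⟩
    obtain ⟨P, Q, hP, hQ, hPQ⟩ := hAB.symm
    let e : Fin (1 + n) ≃ Fin 1 ⊕ Fin n := finSumFinEquiv.symm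
    refine ⟨fun i => d * t (e i), ?_, (u : ℤ) • (P * L.submatrix e e), R.submatrix e e * Q,
      ?_, ?_, ?_⟩
    · intro i j hij
      apply mul_dvd_mul_left
      obtain ⟨i, rfl⟩ := e.symm.surjective i
      obtain ⟨j, rfl⟩ := e.symm.surjective j
      rcases i with i | i <;> rcases j with j | j
      · simp [t]
      · simp [t]
      · exfalso
        simp only [e, Equiv.symm_symm, finSumFinEquiv_apply_left, finSumFinEquiv_apply_right,
          Fin.le_def, Fin.val_natAdd, Fin.val_castAdd] at hij
        omega
      · simp only [Equiv.apply_symm_apply, t, Sum.elim_inr]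
        apply hs
        simp only [e, Equiv.symm_symm, finSumFinEquiv_apply_right,
          Fin.le_def, Fin.val_natAdd] at hij
        rw [Fin.le_def]
        omega
    · rw [Matrix.det_smul, Matrix.det_mul, Matrix.det_submatrix_equiv_self]
      refine ((Units.isUnit u).pow _).mul (hP.mul ?_)
      simpa [L, Matrix.det_fromBlocks_zero₁₂] using hU
    · rw [Matrix.det_mul, Matrix.det_submatrix_equiv_self]
      refine IsUnit.mul ?_ hQ
      simpa [R, Matrix.det_fromBlocks_zero₂₁] using hV
    · have hBC : B = (B z z) • Matrix.of C := by
        ext i j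
        rw [hC i j]
        simp
      have hCe : Matrix.of C = L.submatrix e e *
          Matrix.diagonal (fun i => (t (e i) : ℤ)) * R.submatrix e e := by
        have h := congrArg (fun X => X.submatrix e e) hfac
        simp only [Matrix.submatrix_submatrix] at h
        rw [← Matrix.submatrix_mul_equiv _ _ e e e, ← Matrix.submatrix_mul_equiv _ _ e e e,
          Matrix.submatrix_diagonal_equiv] at h
        have h3 : (finSumFinEquiv ∘ e : Fin (1 + n) → Fin (1 + n)) = id := by
          ext i; simp [e]
        rw [h3, Matrix.submatrix_id_id] at h
        exact h
      have hdiag : Matrix.diagonal (fun i => ((d * t (e i) : ℕ) : ℤ)) =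
          (d : ℤ) • Matrix.diagonal (fun i => (t (e i) : ℤ)) := by
        rw [← Matrix.diagonal_smul]
        congr 1
      rw [hPQ, hBC, hCe, hu, hdiag]
      simp only [Matrix.mul_smul, Matrix.smul_mul, smul_smul, Matrix.mul_assoc, mul_comm]

/-- The `i`-th invariant factor `s_i(A)`, for `1 ≤ i ≤ n`, of an `n × n` integer matrix `A`: the
`i`-th diagonal entry of its (unique) Smith form (zero for other indices, which are never used). -/
noncomputable def invariantFactor {n : ℕ} (A : Matrix (Fin n) (Fin n) ℤ) (i : ℕ) : ℕ :=
  if h : 1 ≤ i ∧ i ≤ n then (exists_isSmithForm A).choose ⟨i - 1, by omega⟩ else 0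

/-- `μ_k(A) = s_1(A) ⋯ s_k(A)`, the product of the `k` smallest invariant factors. -/
noncomputable def smallInvariantProduct {n : ℕ} (k : ℕ) (A : Matrix (Fin n) (Fin n) ℤ) : ℕ :=
  ∏ i ∈ Finset.Icc 1 k, invariantFactor A i

/-- `π_k(A) = s_{n-k+1}(A) ⋯ s_n(A)`, the product of the `k` biggest invariant factors
(for `k ≤ n`). -/
noncomputable def largeInvariantProduct {n : ℕ} (k : ℕ) (A : Matrix (Fin n) (Fin n) ℤ) : ℕ :=
  ∏ i ∈ Finset.Icc (n - k + 1) n, invariantFactor A i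

/-- `‖A‖`, the largest absolute value of an entry of `A`. -/
def maxAbsEntry {n : ℕ} (A : Matrix (Fin n) (Fin n) ℤ) : ℕ :=
  Finset.univ.sup fun i => Finset.univ.sup fun j => (A i j).natAbs

/-- The Hadamard bound `H = (√n ‖A‖)^n` for the determinant of `A`. -/
noncomputable def hadamardBound {n : ℕ} (A : Matrix (Fin n) (Fin n) ℤ) : ℝ :=
  (Real.sqrt n * maxAbsEntry A) ^ n

/-- The finite set of all `m × n` matrices with entries in the set `{a, a + 1, …, a + S - 1}` of
`S` contiguous integers. A uniformly random element of it is a random matrix whose entries are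
independent and uniform on `{a, a + 1, …, a + S - 1}`. -/
noncomputable def contiguousMatrices (m n : ℕ) (a : ℤ) (S : ℕ) : Finset (Matrix (Fin m) (Fin n) ℤ) :=
  Fintype.piFinset fun _ => Fintype.piFinset fun _ => Finset.Ico a (a + S)

/-- `π_k(A) / s_n(A)^k · gcd(μ_k(R₁ M B₁), μ_k(R₂ M B₂), s_n(A)^k)`: the factor by which the
product of the `k` biggest invariant factors of `A` is under-approximated. -/
noncomputable def underApproximation {n k : ℕ} (A M : Matrix (Fin n) (Fin n) ℤ)
    (B₁ B₂ : Matrix (Fin n) (Fin k) ℤ) (R₁ R₂ : Matrix (Fin k) (Fin n) ℤ) : ℝ :=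
  (largeInvariantProduct k A : ℝ) / (invariantFactor A n : ℝ) ^ k *
    (Nat.gcd (Nat.gcd (smallInvariantProduct k (R₁ * M * B₁))
      (smallInvariantProduct k (R₂ * M * B₂))) (invariantFactor A n ^ k) : ℕ)

/-- The expectation of the logarithm of the under-approximation when all the entries of
`B₁`, `B₂`, `R₁`, `R₂` are independent and uniform on `{a, a + 1, …, a + S - 1}`, that is, its
average over the finite set of all equally likely outcomes. -/
noncomputable def expectedLogUnderApproximation {n : ℕ} (k : ℕ) (A M : Matrix (Fin n) (Fin n) ℤ)
    (a : ℤ) (S : ℕ) : ℝ :=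
  (contiguousMatrices n k a S).expect fun B₁ => (contiguousMatrices n k a S).expect fun B₂ =>
    (contiguousMatrices k n a S).expect fun R₁ => (contiguousMatrices k n a S).expect fun R₂ =>
      Real.log (underApproximation A M B₁ B₂ R₁ R₂)

/-!
The under-approximation is a greatest common divisor. Write `M = s_n A⁻¹ = U * diag(d) * V` with
`U`, `V` unimodular and `d_i = s_n / s_{n + 1 - i}`, a divisibility chain, and put
`μ = d_1 ⋯ d_k`, so that `μ * π_k(A) = s_n ^ k`. Expanding the determinant shows that `μ` divides
`det (R * M * B)`, and with `F(R, B) = det (R * M * B) / μ` the under-approximation is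
`gcd (F(R₁, B₁), F(R₂, B₂), π_k(A))` (`underApproximation_eq`). Its logarithm is therefore
nonnegative, and it has to be bounded from above.

*Determinants of random compressions.* Let `W` be a `k × n` integer matrix with a right inverse and
`B` random. Exposing the first column `b` of `B` and clearing `W b` by a unimodular transformation
shows that `det (W * B)` is, up to sign, the content of `W b` times a determinant of the same kind
of size `k - 1` (`Matrix.exists_det_mul_cons`). A prime power `q = p ^ m` divides the content only
if `k` independent linear forms vanish modulo `q`, which has probability at most
`(1 / q + 1 / S) ^ k` (`card_filter_dvd_mulVec_le`). Hence the expected `p`-adic valuation of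
`det (W * B)`, truncated at `K`, is at most `∑ m ≤ K, ∑ c ≤ k, (1 / p ^ m + 1 / S) ^ c`, which is
`O(1 / p + K / S)` uniformly in `k` (`expect_logGcd_det_mul_le`, `sum_sum_pow_le`).

*Two-sided compressions.* For fixed `R` one can write `R * M = T * W` with `W` right invertible, and
comparing the first `k` columns of `R * U * diag(d)` shows that `det T` divides `μ` times the
determinant of `R` times the first `k` columns of `U`. So `F(R, B)` divides a product of two
determinants of the previous kind (`Matrix.exists_det_compression_dvd`).

*Summing over the primes.* Let `K` be the exponent of `p` in `π_k(A)`. The contribution of `p` is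
nonzero only if `p` divides `F(R₁, B₁)`, and it is then at most `log p` times the truncated
valuation of `F(R₂, B₂)`. By independence its expectation is at most a constant times
`log p * (1 / p + 1 / S) * (1 / p + K / S)`, which is `O(log p / p ^ 2 + K * log p / S)`. As
`∑ log p / p ^ 2` converges and `∑ K * log p = log π_k(A) ≤ log |det A| ≤ 2 * log H`, the
expectation is `O(1) + O(log H / S)` (`exists_expect_logGcd_gcd_le`), which is stronger than the
stated bound since `log H ≥ log 2`.
-/

/-! ### Determinants of products of rectangular integer matrices -/

/-- Multilinear expansion of the determinant of a product of rectangular matrices, over all maps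
rather than over subsets of the index set. -/
theorem Matrix.det_mul_eq_sum_submatrix {R ι : Type*} [CommRing R] [Fintype ι] [DecidableEq ι]
    {k : ℕ} (Y : Matrix (Fin k) ι R) (Z : Matrix ι (Fin k) R) :
    (Y * Z).det = ∑ f : Fin k → ι, (∏ i, Z (f i) i) * (Y.submatrix id f).det := by
  rw [← Matrix.det_transpose]
  have h : (Y * Z).transpose = fun i => ∑ j, Z j i • Y.transpose j := by
    ext i l
    simp [Matrix.mul_apply, Finset.sum_apply, mul_comm]
  change Matrix.detRowAlternating ((Y * Z).transpose) = _
  rw [h]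
  change Matrix.detRowAlternating.toMultilinearMap _ = _
  rw [MultilinearMap.map_sum]
  refine Finset.sum_congr rfl fun f _ => ?_
  rw [MultilinearMap.map_smul_univ, smul_eq_mul, ← Matrix.det_transpose (Y.submatrix id f)]
  rfl

/-- In the expansion of `det (Y * Z)` the non-injective maps contribute nothing. -/
theorem Matrix.det_submatrix_eq_zero_of_not_injective {R ι : Type*} [CommRing R]
    {k : ℕ} (Y : Matrix (Fin k) ι R) {f : Fin k → ι} (hf : ¬ Function.Injective f) :
    (Y.submatrix id f).det = 0 := by
  simp only [Function.Injective, not_forall] at hf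
  obtain ⟨i, j, hij, hne⟩ := hf
  exact Matrix.det_zero_of_column_eq hne fun l => by simp [hij]

theorem Fin.sum_eq_sum_castLE {M : Type*} [AddCommMonoid M] {k n : ℕ} (h : k ≤ n) (g : Fin n → M)
    (hg : ∀ l : Fin n, k ≤ l → g l = 0) : ∑ l, g l = ∑ l : Fin k, g (Fin.castLE h l) := by
  obtain ⟨m, rfl⟩ := Nat.exists_eq_add_of_le h
  rw [Fin.sum_univ_add]
  rw [Finset.sum_eq_zero (f := fun i => g (Fin.natAdd k i)) fun i _ => hg _ (by simp), add_zero]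
  rfl

/-- The number of nonzero entries of a Smith form is the rank over the rationals. -/
theorem Matrix.rank_map_mul_diagonal_mul {n : ℕ} (U V : Matrix (Fin n) (Fin n) ℤ) (s : Fin n → ℕ)
    (hU : IsUnit U.det) (hV : IsUnit V.det) :
    ((U * Matrix.diagonal (fun i => (s i : ℤ)) * V).map (Int.cast : ℤ → ℚ)).rank =
      Fintype.card {i // s i ≠ 0} := by
  have hc : ∀ X : Matrix (Fin n) (Fin n) ℤ, X.map (Int.cast : ℤ → ℚ) = (Int.castRingHom ℚ).mapMatrix X :=
    fun X => rfl
  have hu : ∀ X : Matrix (Fin n) (Fin n) ℤ, IsUnit X.det →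
      IsUnit ((Int.castRingHom ℚ).mapMatrix X).det := fun X hX => by
    rw [← RingHom.map_det]; exact hX.map _
  rw [hc, map_mul, map_mul, Matrix.rank_mul_eq_left_of_isUnit_det _ _ (hu V hV),
    Matrix.rank_mul_eq_right_of_isUnit_det _ _ (hu U hU)]
  have hd : (Int.castRingHom ℚ).mapMatrix (Matrix.diagonal (fun i => (s i : ℤ))) =
      Matrix.diagonal (fun i => (s i : ℚ)) := by
    ext i j
    by_cases hij : i = j
    · subst hij; simp
    · simp [hij]
  rw [hd, Matrix.rank_diagonal]
  exact Fintype.card_congr (Equiv.subtypeEquivRight fun i => by simp)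

/-- An integer matrix with at most as many rows as columns is a square matrix times the first rows
of a unimodular matrix. -/
theorem Matrix.exists_mul_unimodular_rows {k n : ℕ} (h : k ≤ n) (N : Matrix (Fin k) (Fin n) ℤ) :
    ∃ (T : Matrix (Fin k) (Fin k) ℤ) (V : Matrix (Fin n) (Fin n) ℤ), IsUnit V.det ∧
      N = T * V.submatrix (Fin.castLE h) id := by
  -- Pad `N` by zero rows. Since its rank is at most `k`, its Smith form vanishes after `k` places.
  let E : Matrix (Fin n) (Fin k) ℤ := (1 : Matrix (Fin n) (Fin n) ℤ).submatrix id (Fin.castLE h)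
  obtain ⟨s, hs, U, V, hU, hV, hUV⟩ := exists_isSmithForm (E * N)
  have hz : ∀ l : Fin n, k ≤ l → s l = 0 := by
    intro l hl
    by_contra hne
    have hr : ((E * N).map (Int.cast : ℤ → ℚ)).rank ≤ k := by
      have : (E * N).map (Int.cast : ℤ → ℚ) = E.map (Int.cast : ℤ → ℚ) * N.map (Int.cast : ℤ → ℚ) :=
        Matrix.map_mul (f := Int.castRingHom ℚ)
      rw [this]
      exact (Matrix.rank_mul_le_right _ _).trans (Matrix.rank_le_height _)
    rw [hUV, Matrix.rank_map_mul_diagonal_mul U V s hU hV, Fintype.card_subtype] at hr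
    have hsub : Finset.Iic l ⊆ Finset.univ.filter fun i => s i ≠ 0 := by
      intro i hi
      simp only [Finset.mem_filter, Finset.mem_univ, true_and]
      intro h0
      exact hne (Nat.eq_zero_of_zero_dvd (h0 ▸ hs i l (Finset.mem_Iic.1 hi)))
    have := Finset.card_le_card hsub
    rw [Fin.card_Iic] at this
    omega
  refine ⟨Matrix.of fun i j => U (Fin.castLE h i) (Fin.castLE h j) * s (Fin.castLE h j), V, hV, ?_⟩
  ext i j
  have hN : N i j = (E * N) (Fin.castLE h i) j := by
    simp [E, Matrix.mul_apply, Matrix.one_apply, (Fin.castLE_injective h).eq_iff]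
  rw [hN, hUV, Matrix.mul_apply, Fin.sum_eq_sum_castLE h _ fun l hl => by simp [hz l hl]]
  simp only [Matrix.mul_diagonal]
  simp [Matrix.mul_apply]

/-- A unimodular transformation clears all but the first coordinate of an integer vector. -/
theorem Matrix.exists_unimodular_mulVec_eq_single {k : ℕ} (w : Fin (k + 1) → ℤ) :
    ∃ (G : Matrix (Fin (k + 1)) (Fin (k + 1)) ℤ) (g : ℤ), IsUnit G.det ∧
      G.mulVec w = Pi.single 0 g := by
  -- Regarded as a single row, `w` is a multiple of the first row of a unimodular matrix.
  obtain ⟨T, V, hV, hN⟩ := Matrix.exists_mul_unimodular_rows (k := 1) (n := k + 1) (by omega)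
    (Matrix.of fun _ => w)
  have hw : w = V.transpose.mulVec (Pi.single 0 (T 0 0)) := by
    ext j
    have := congrFun (congrFun hN 0) j
    simp only [Matrix.of_apply, Matrix.mul_apply, Finset.univ_unique, Fin.default_eq_zero,
      Finset.sum_singleton, Matrix.submatrix_apply, id] at this
    rw [this, Matrix.mulVec_single]
    simpa using mul_comm _ _
  have hV' : IsUnit V.transpose.det := by simpa using hV
  refine ⟨V.transpose⁻¹, T 0 0, Matrix.isUnit_nonsing_inv_det _ hV', ?_⟩
  rw [hw, Matrix.mulVec_mulVec, Matrix.nonsing_inv_mul _ hV', Matrix.one_mulVec]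

/-- Exposing the first column `b` of `B` in `det (W * B)`, where `W` has a right inverse: up to
sign, the determinant is the content of `W b` times a determinant of the same kind in the
remaining columns. -/
theorem Matrix.exists_det_mul_cons {k n : ℕ} (W : Matrix (Fin (k + 1)) (Fin n) ℤ)
    (X : Matrix (Fin n) (Fin (k + 1)) ℤ) (hWX : W * X = 1) (b : Fin n → ℤ) :
    ∃ (g : ℤ) (W' : Matrix (Fin k) (Fin n) ℤ) (X' : Matrix (Fin n) (Fin k) ℤ), W' * X' = 1 ∧
      (∀ i, g ∣ W.mulVec b i) ∧ ∀ C : Fin k → Fin n → ℤ,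
        (W * (Matrix.of (Fin.cons b C : Fin (k + 1) → Fin n → ℤ)).transpose).det ∣
          g * (W' * (Matrix.of C).transpose).det := by
  obtain ⟨G, g, hG, hg⟩ := Matrix.exists_unimodular_mulVec_eq_single (W.mulVec b)
  refine ⟨g, (G * W).submatrix Fin.succ id, (X * G⁻¹).submatrix id Fin.succ, ?_, ?_, ?_⟩
  · have h1 : (G * W) * (X * G⁻¹) = 1 := by
      rw [Matrix.mul_assoc, ← Matrix.mul_assoc W, hWX, Matrix.one_mul, Matrix.mul_nonsing_inv _ hG]
    rw [← Matrix.submatrix_mul _ _ Fin.succ id Fin.succ Function.bijective_id, h1,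
      Matrix.submatrix_one _ (Fin.succ_injective _)]
  · intro i
    have h1 : W.mulVec b = G⁻¹.mulVec (Pi.single 0 g) := by
      rw [← hg, Matrix.mulVec_mulVec, Matrix.nonsing_inv_mul _ hG, Matrix.one_mulVec]
    rw [h1, Matrix.mulVec_single]
    simp
  · intro C
    set B := (Matrix.of (Fin.cons b C : Fin (k + 1) → Fin n → ℤ)).transpose with hB
    have hcol : ∀ i, (G * (W * B)) i 0 = (Pi.single 0 g : Fin (k + 1) → ℤ) i := by
      intro i
      rw [← hg, Matrix.mulVec_mulVec, ← Matrix.mul_assoc]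
      simp [Matrix.mul_apply, Matrix.mulVec, dotProduct, hB]
    have hsub : (G * (W * B)).submatrix Fin.succ Fin.succ =
        (G * W).submatrix Fin.succ id * (Matrix.of C).transpose := by
      ext i j
      rw [← Matrix.mul_assoc]
      simp [Matrix.mul_apply, hB]
    have hdet : (G * (W * B)).det =
        g * ((G * W).submatrix Fin.succ id * (Matrix.of C).transpose).det := by
      rw [Matrix.det_succ_column_zero, Finset.sum_eq_single 0]
      · rw [hcol 0, ← hsub]
        simp [Fin.succAbove_zero]
      · intro i _ hi
        rw [hcol i]
        simp [hi]
      · simp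
    rw [← hdet, Matrix.det_mul]
    exact dvd_mul_left _ _

theorem StrictMono.val_le_val_apply {k n : ℕ} {f : Fin k → Fin n} (hf : StrictMono f)
    (i : Fin k) : (i : ℕ) ≤ f i := by
  obtain ⟨m, hm⟩ := i
  induction m with
  | zero => exact Nat.zero_le _
  | succ m ih =>
    have h1 := ih (by omega)
    have h2 : f ⟨m, by omega⟩ < f ⟨m + 1, hm⟩ := hf (by simp [Fin.lt_def])
    rw [Fin.lt_def] at h2
    simp only at h1 ⊢
    omega

/-- If `d` is a divisibility chain, the product of its first `k` terms divides the product of any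
`k` terms with distinct indices. -/
theorem prod_castLE_dvd_prod_of_injective {k n : ℕ} (h : k ≤ n) (d : Fin n → ℕ)
    (hd : ∀ i j, i ≤ j → d i ∣ d j) {f : Fin k → Fin n} (hf : Function.Injective f) :
    ∏ i, d (Fin.castLE h i) ∣ ∏ i, d (f i) := by
  have hcard : (Finset.univ.image f).card = k := by
    rw [Finset.card_image_of_injective _ hf, Finset.card_univ, Fintype.card_fin]
  have h1 : ∏ i, d (f i) = ∏ i, d ((Finset.univ.image f).orderEmbOfFin hcard i) := by
    rw [← Finset.prod_image (s := Finset.univ) (g := f) (f := d) fun x _ y _ hxy => hf hxy,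
      ← Finset.prod_image (s := Finset.univ)
        (g := (Finset.univ.image f).orderEmbOfFin hcard) (f := d)
        fun x _ y _ hxy => ((Finset.univ.image f).orderEmbOfFin hcard).injective hxy]
    congr 1
    exact (Finset.image_orderEmbOfFin_univ _ _).symm
  rw [h1]
  refine Finset.prod_dvd_prod_of_dvd _ _ fun i _ => hd _ _ ?_
  exact StrictMono.val_le_val_apply ((Finset.univ.image f).orderEmbOfFin hcard).strictMono i

/-- The product of the first `k` entries of a divisibility chain `d` divides the determinants of
all `k × k` compressions of `diag(d)`. -/
theorem Matrix.prod_castLE_dvd_det_mul_diagonal_mul {k n : ℕ} (h : k ≤ n) (d : Fin n → ℕ)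
    (hd : ∀ i j, i ≤ j → d i ∣ d j) (Y : Matrix (Fin k) (Fin n) ℤ) (Z : Matrix (Fin n) (Fin k) ℤ) :
    ((∏ i, d (Fin.castLE h i) : ℕ) : ℤ) ∣
      (Y * Matrix.diagonal (fun i => (d i : ℤ)) * Z).det := by
  rw [Matrix.mul_assoc, Matrix.det_mul_eq_sum_submatrix]
  refine Finset.dvd_sum fun f _ => ?_
  by_cases hf : Function.Injective f
  · simp only [Matrix.diagonal_mul, Finset.prod_mul_distrib]
    rw [mul_assoc]
    refine Dvd.dvd.mul_right ?_ _
    exact_mod_cast prod_castLE_dvd_prod_of_injective h d hd hf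
  · rw [Matrix.det_submatrix_eq_zero_of_not_injective _ hf, mul_zero]
    exact dvd_zero _

/-! ### Valuations of determinants with random columns -/

/-- The logarithm of `gcd(x, N)`. For a prime power `N = p ^ K` it is `log p` times the `p`-adic
valuation of `x` truncated at `K`, so that `x = 0` needs no special treatment. -/
noncomputable def logGcd (x : ℤ) (N : ℕ) : ℝ := Real.log (x.natAbs.gcd N)

theorem logGcd_nonneg (x : ℤ) (N : ℕ) : 0 ≤ logGcd x N := Real.log_natCast_nonneg _

theorem logGcd_le_of_dvd {x y : ℤ} {N : ℕ} (hN : N ≠ 0) (h : x ∣ y) : logGcd x N ≤ logGcd y N := by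
  have h1 : x.natAbs.gcd N ∣ y.natAbs.gcd N := Nat.gcd_dvd_gcd_of_dvd_left _ (Int.natAbs_dvd_natAbs.2 h)
  have h2 : 0 < y.natAbs.gcd N := Nat.gcd_pos_of_pos_right _ (Nat.pos_of_ne_zero hN)
  have h3 : 0 < x.natAbs.gcd N := Nat.gcd_pos_of_pos_right _ (Nat.pos_of_ne_zero hN)
  exact Real.log_le_log (by exact_mod_cast h3) (by exact_mod_cast Nat.le_of_dvd h2 h1)

theorem logGcd_mul_le (x y : ℤ) {N : ℕ} (hN : N ≠ 0) :
    logGcd (x * y) N ≤ logGcd x N + logGcd y N := by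
  have hx : 0 < x.natAbs.gcd N := Nat.gcd_pos_of_pos_right _ (Nat.pos_of_ne_zero hN)
  have hy : 0 < y.natAbs.gcd N := Nat.gcd_pos_of_pos_right _ (Nat.pos_of_ne_zero hN)
  have hxy : 0 < (x * y).natAbs.gcd N := Nat.gcd_pos_of_pos_right _ (Nat.pos_of_ne_zero hN)
  have h1 : (x * y).natAbs.gcd N ≤ x.natAbs.gcd N * y.natAbs.gcd N := by
    apply Nat.le_of_dvd (Nat.mul_pos hx hy)
    rw [Int.natAbs_mul, Nat.gcd_comm, Nat.gcd_comm _ N, Nat.gcd_comm _ N]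
    exact Nat.gcd_mul_right_dvd_mul_gcd _ _ _
  rw [logGcd, logGcd, logGcd, ← Real.log_mul (by exact_mod_cast hx.ne') (by exact_mod_cast hy.ne')]
  exact Real.log_le_log (by exact_mod_cast hxy) (by exact_mod_cast h1)

theorem logGcd_prime_pow (x : ℤ) {p : ℕ} (hp : p.Prime) (K : ℕ) :
    logGcd x (p ^ K) =
      Real.log p * ∑ m ∈ Finset.Icc 1 K, if ((p : ℤ) ^ m ∣ x) then 1 else 0 := by
  obtain ⟨j, hj, hg⟩ := (Nat.dvd_prime_pow hp).1 (Nat.gcd_dvd_right x.natAbs (p ^ K))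
  have h1 : (Finset.Icc 1 K).filter (fun m => (p : ℤ) ^ m ∣ x) = Finset.Icc 1 j := by
    ext m
    have : ∀ m ≤ K, ((p : ℤ) ^ m ∣ x ↔ m ≤ j) := by
      intro m hm
      rw [← Nat.pow_dvd_pow_iff_le_right hp.one_lt, ← hg, Nat.dvd_gcd_iff]
      rw [← Int.natAbs_dvd_natAbs, Int.natAbs_pow, Int.natAbs_natCast]
      exact ⟨fun h => ⟨h, pow_dvd_pow _ hm⟩, fun h => h.1⟩
    simp only [Finset.mem_filter, Finset.mem_Icc]
    constructor
    · rintro ⟨⟨h1, h2⟩, h3⟩; exact ⟨h1, (this m h2).1 h3⟩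
    · rintro ⟨h1, h2⟩; exact ⟨⟨h1, h2.trans hj⟩, (this m (h2.trans hj)).2 h2⟩
  rw [Finset.sum_boole, h1, logGcd, hg]
  simp [mul_comm]

/-- In an interval of `S` integers each residue class modulo `q` has frequency at most
`1 / q + 1 / S`. -/
theorem card_Ico_filter_modEq_le (a r : ℤ) (S q : ℕ) (hS : S ≠ 0) (hq : q ≠ 0) :
    (((Finset.Ico a (a + S)).filter fun x => x ≡ r [ZMOD q]).card : ℝ) ≤
      (1 / q + 1 / S) * (Finset.Ico a (a + S)).card := by
  have h := Int.Ico_filter_modEq_card a (a + S) (r := (q : ℤ)) (by positivity) r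
  have hle : ((((Finset.Ico a (a + S)).filter fun x => x ≡ r [ZMOD q]).card : ℤ) : ℚ) ≤ S / q + 1 := by
    rw [h]
    have h1 := Int.ceil_lt_add_one ((((a + S : ℤ) : ℚ) - r) / ((q : ℤ) : ℚ))
    have h2 := Int.le_ceil (((a : ℚ) - r) / ((q : ℤ) : ℚ))
    have h3 : (((a + S : ℤ) : ℚ) - r) / ((q : ℤ) : ℚ) = ((a : ℚ) - r) / ((q : ℤ) : ℚ) + S / q := by
      push_cast; ring
    have h4 : (0 : ℚ) ≤ S / q := by positivity
    rw [Int.cast_max]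
    refine max_le ?_ (by push_cast; linarith)
    rw [h3] at h1
    push_cast at *
    rw [h3]
    linarith
  have hle' : (((Finset.Ico a (a + S)).filter fun x => x ≡ r [ZMOD q]).card : ℝ) ≤ S / q + 1 := by
    have h1 := (Rat.cast_le (K := ℝ)).2 hle
    push_cast at h1
    exact h1
  refine hle'.trans (le_of_eq ?_)
  have : (S : ℝ) ≠ 0 := by exact_mod_cast hS
  simp only [Int.card_Ico, add_sub_cancel_left, Int.toNat_natCast]
  field_simp

/-- A system of `c` integer linear forms with a right inverse vanishes modulo a prime power with
probability at most `β ^ c` when the variables are independent with residue frequencies at most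
`β`. -/
theorem card_filter_dvd_mulVec_le {c n : ℕ} (W : Matrix (Fin c) (Fin n) ℤ)
    (X : Matrix (Fin n) (Fin c) ℤ) (hWX : W * X = 1) {p : ℕ} (hp : p.Prime) (m : ℕ)
    (I : Finset ℤ) (β : ℝ)
    (hβ : ∀ r : ℤ, ((I.filter fun x => x ≡ r [ZMOD (p ^ m : ℕ)]).card : ℝ) ≤ β * I.card) :
    (((Fintype.piFinset fun _ : Fin n => I).filter
      fun b => ∀ i, (p : ℤ) ^ m ∣ W.mulVec b i).card : ℝ) ≤ β ^ c * (I.card : ℝ) ^ n := by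
  classical
  -- Some maximal minor of `W` is prime to `p`, as these minors generate `det (W * X) = 1`.
  obtain ⟨f, hf⟩ : ∃ f : Fin c → Fin n, ¬ (p : ℤ) ∣ (W.submatrix id f).det := by
    by_contra hcon
    push Not at hcon
    have h1 : (p : ℤ) ∣ (W * X).det := by
      rw [Matrix.det_mul_eq_sum_submatrix]
      exact Finset.dvd_sum fun f _ => (hcon f).mul_left _
    rw [hWX, Matrix.det_one] at h1
    exact hp.one_lt.ne' (by simpa using Int.eq_one_of_dvd_one (by positivity) h1)
  have hinj : Function.Injective f := by
    by_contra hni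
    exact hf (by rw [Matrix.det_submatrix_eq_zero_of_not_injective _ hni]; exact dvd_zero _)
  set Z := (Fintype.piFinset fun _ : Fin n => I).filter fun b => ∀ i, (p : ℤ) ^ m ∣ W.mulVec b i
  -- Solutions agreeing outside the columns of the minor agree modulo `p ^ m` on these columns.
  have key : ∀ b ∈ Z, ∀ b' ∈ Z, (∀ j, j ∉ Set.range f → b j = b' j) →
      ∀ i, b (f i) ≡ b' (f i) [ZMOD (p ^ m : ℕ)] := by
    intro b hb b' hb' hbb
    have hb := (Finset.mem_filter.1 hb).2
    have hb' := (Finset.mem_filter.1 hb').2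
    set w : Fin c → ℤ := fun i => b (f i) - b' (f i)
    have h1 : ∀ i, (p : ℤ) ^ m ∣ (W.submatrix id f).mulVec w i := by
      intro i
      have h2 : (W.submatrix id f).mulVec w i = W.mulVec b i - W.mulVec b' i := by
        simp only [Matrix.mulVec, dotProduct, Matrix.submatrix_apply, id, w]
        rw [← Finset.sum_sub_distrib]
        rw [← Finset.sum_subset (Finset.subset_univ (Finset.univ.image f)),
          Finset.sum_image fun x _ y _ hxy => hinj hxy]
        · exact Finset.sum_congr rfl fun _ _ => by ring
        · intro j _ hj
          rw [hbb j (by simpa using hj)]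
          ring
      rw [h2]
      exact dvd_sub (hb i) (hb' i)
    intro i
    have h3 : (p : ℤ) ^ m ∣ (W.submatrix id f).det * w i := by
      have h4 : (W.submatrix id f).det * w i =
          (W.submatrix id f).adjugate.mulVec ((W.submatrix id f).mulVec w) i := by
        rw [Matrix.mulVec_mulVec, Matrix.adjugate_mul, Matrix.smul_mulVec, Matrix.one_mulVec]
        rfl
      rw [h4, Matrix.mulVec, dotProduct]
      exact Finset.dvd_sum fun j _ => (h1 j).mul_left _
    have hcop : IsCoprime ((p : ℤ) ^ m) (W.submatrix id f).det :=
      ((Nat.prime_iff_prime_int.1 hp).coprime_iff_not_dvd.2 hf).pow_left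
    have h5 := hcop.dvd_of_dvd_mul_left h3
    refine (Int.modEq_iff_dvd.2 ?_).symm
    push_cast
    exact h5
  let res : (Fin n → ℤ) → ({j // j ∉ Set.range f} → ℤ) := fun b j => b j
  have hβ0 : 0 ≤ β * I.card := le_trans (Nat.cast_nonneg _) (hβ 0)
  have hfib : ∀ y ∈ Z.image res, ((Z.filter fun b => res b = y).card : ℝ) ≤ (β * I.card) ^ c := by
    intro y hy
    obtain ⟨b₀, hb₀, rfl⟩ := Finset.mem_image.1 hy
    have h1 : (Z.filter fun b => res b = res b₀).card ≤
        (Fintype.piFinset fun i : Fin c => I.filter fun x => x ≡ b₀ (f i) [ZMOD (p ^ m : ℕ)]).card := by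
      refine Finset.card_le_card_of_injOn (fun b i => b (f i)) ?_ ?_
      · intro b hb
        obtain ⟨hbZ, hbr⟩ := Finset.mem_filter.1 hb
        simp only [Finset.mem_coe, Fintype.mem_piFinset, Finset.mem_filter]
        intro i
        exact ⟨Fintype.mem_piFinset.1 (Finset.mem_filter.1 hbZ).1 _,
          key b hbZ b₀ hb₀ (fun j hj => congrFun hbr ⟨j, hj⟩) i⟩
      · intro b hb b' hb' hbb
        have hr := (Finset.mem_filter.1 hb).2.trans (Finset.mem_filter.1 hb').2.symm
        ext j
        by_cases hj : j ∈ Set.range f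
        · obtain ⟨i, rfl⟩ := hj
          exact congrFun hbb i
        · exact congrFun hr ⟨j, hj⟩
    refine (Nat.cast_le.2 h1).trans ?_
    rw [Fintype.card_piFinset, Nat.cast_prod]
    calc _ ≤ ∏ _i : Fin c, β * (I.card : ℝ) :=
          Finset.prod_le_prod (fun _ _ => Nat.cast_nonneg _) fun i _ => hβ _
      _ = _ := by simp
  have hcn : c ≤ n := by simpa using Fintype.card_le_of_injective f hinj
  have himg : ((Z.image res).card : ℝ) ≤ (I.card : ℝ) ^ (n - c) := by
    have h1 : (Z.image res).card ≤ (Fintype.piFinset fun _ : {j // j ∉ Set.range f} => I).card := by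
      refine Finset.card_le_card fun y hy => ?_
      obtain ⟨b, hb, rfl⟩ := Finset.mem_image.1 hy
      exact Fintype.mem_piFinset.2 fun j => Fintype.mem_piFinset.1 (Finset.mem_filter.1 hb).1 _
    have h2 : Fintype.card {j // j ∉ Set.range f} = n - c := by
      rw [Fintype.card_subtype_compl, Fintype.card_fin,
        ← Fintype.card_congr (Equiv.ofInjective f hinj), Fintype.card_fin]
    rw [Fintype.card_piFinset, Finset.prod_const, Finset.card_univ, h2] at h1
    exact_mod_cast h1
  calc (Z.card : ℝ) = ∑ y ∈ Z.image res, ((Z.filter fun b => res b = y).card : ℝ) := by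
        exact_mod_cast Finset.card_eq_sum_card_image res Z
    _ ≤ (Z.image res).card • (β * I.card) ^ c := Finset.sum_le_card_nsmul _ _ _ hfib
    _ ≤ (I.card : ℝ) ^ (n - c) * (β * I.card) ^ c := by
        rw [nsmul_eq_mul]; gcongr
    _ = β ^ c * (I.card : ℝ) ^ n := by
        rw [mul_pow, mul_left_comm, ← pow_add, Nat.sub_add_cancel hcn]

theorem Finset.expect_piFinset_succ {α : Type*} {k : ℕ} (s : Finset α)
    (f : (Fin (k + 1) → α) → ℝ) :
    (Fintype.piFinset fun _ : Fin (k + 1) => s).expect f =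
      s.expect fun b => (Fintype.piFinset fun _ : Fin k => s).expect fun C => f (Fin.cons b C) := by
  rw [← Finset.expect_product' s _ fun b C => f (Fin.cons b C)]
  refine (Finset.expect_equiv (Fin.consEquiv fun _ => α) ?_ ?_).symm
  · rintro ⟨b, C⟩
    simp [Fintype.mem_piFinset, Fin.forall_fin_succ, Fin.consEquiv]
  · rintro ⟨b, C⟩ _
    rfl

/-- Bound for the expected truncated valuation of `det (W * B)`, where `W` has a right inverse and
`B` has independent entries. When the columns of `B` are exposed one after the other, the
valuation grows by that of the common divisor of `k, k - 1, …, 1` independent linear forms. -/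
theorem expect_logGcd_det_mul_le {k n : ℕ} (W : Matrix (Fin k) (Fin n) ℤ)
    (X : Matrix (Fin n) (Fin k) ℤ) (hWX : W * X = 1) {p : ℕ} (hp : p.Prime) (K : ℕ)
    (I : Finset ℤ) (hI : I.Nonempty) (β : ℕ → ℝ)
    (hβ : ∀ (m : ℕ) (r : ℤ),
      ((I.filter fun x => x ≡ r [ZMOD (p ^ m : ℕ)]).card : ℝ) ≤ β m * I.card) :
    ((Fintype.piFinset fun _ : Fin k => Fintype.piFinset fun _ : Fin n => I).expect
      fun C => logGcd (W * (Matrix.of C).transpose).det (p ^ K)) ≤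
      Real.log p * ∑ m ∈ Finset.Icc 1 K, ∑ c ∈ Finset.Icc 1 k, β m ^ c := by
  have hP : p ^ K ≠ 0 := pow_ne_zero _ hp.ne_zero
  induction k with
  | zero =>
    refine Finset.expect_le (by simp) fun C _ => ?_
    simp [logGcd]
  | succ k ih =>
    have hvec : (Fintype.piFinset fun _ : Fin n => I).Nonempty :=
      Fintype.piFinset_nonempty.2 fun _ => hI
    have hmat : (Fintype.piFinset fun _ : Fin k => Fintype.piFinset fun _ : Fin n => I).Nonempty :=
      Fintype.piFinset_nonempty.2 fun _ => hvec
    rw [Finset.expect_piFinset_succ]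
    choose g W' X' hWX' hg hdet using fun b => Matrix.exists_det_mul_cons W X hWX b
    have h1 : ∀ b, ((Fintype.piFinset fun _ : Fin k => Fintype.piFinset fun _ : Fin n => I).expect
        fun C => logGcd (W * (Matrix.of (Fin.cons b C : Fin (k + 1) → Fin n → ℤ)).transpose).det
          (p ^ K)) ≤
        logGcd (g b) (p ^ K) +
          Real.log p * ∑ m ∈ Finset.Icc 1 K, ∑ c ∈ Finset.Icc 1 k, β m ^ c := by
      intro b
      calc _ ≤ (Fintype.piFinset fun _ : Fin k => Fintype.piFinset fun _ : Fin n => I).expect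
            fun C => (logGcd (g b) (p ^ K) +
              logGcd (W' b * (Matrix.of C).transpose).det (p ^ K)) :=
            Finset.expect_le_expect fun C _ =>
              (logGcd_le_of_dvd hP (hdet b C)).trans (logGcd_mul_le _ _ hP)
        _ ≤ _ := by
            rw [Finset.expect_add_distrib, Finset.expect_const hmat]
            exact add_le_add le_rfl (ih (W' b) (X' b) (hWX' b))
    refine (Finset.expect_le_expect fun b _ => h1 b).trans ?_
    rw [Finset.expect_add_distrib, Finset.expect_const hvec]
    have hlog : 0 ≤ Real.log p := Real.log_natCast_nonneg _
    have h2 : ((Fintype.piFinset fun _ : Fin n => I).expect fun b => logGcd (g b) (p ^ K)) ≤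
        Real.log p * ∑ m ∈ Finset.Icc 1 K, β m ^ (k + 1) := by
      simp only [logGcd_prime_pow _ hp]
      rw [← Finset.mul_expect, Finset.expect_sum_comm]
      refine mul_le_mul_of_nonneg_left (Finset.sum_le_sum fun m _ => ?_) hlog
      rw [Finset.expect_eq_sum_div_card, Finset.sum_boole, Fintype.card_piFinset_const,
        Nat.cast_pow, div_le_iff₀ (pow_pos (by exact_mod_cast hI.card_pos) _)]
      refine le_trans ?_ (card_filter_dvd_mulVec_le W X hWX hp m I (β m) (hβ m))
      refine Nat.cast_le.2 (Finset.card_le_card fun b hb => ?_)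
      rw [Finset.mem_filter] at hb ⊢
      exact ⟨hb.1, fun i => hb.2.trans (hg b i)⟩
    calc _ ≤ Real.log p * ∑ m ∈ Finset.Icc 1 K, β m ^ (k + 1) +
          Real.log p * ∑ m ∈ Finset.Icc 1 K, ∑ c ∈ Finset.Icc 1 k, β m ^ c := by gcongr
      _ = _ := by
          rw [← mul_add, ← Finset.sum_add_distrib]
          congr 1
          refine Finset.sum_congr rfl fun m _ => ?_
          rw [Finset.sum_Icc_succ_top (by omega), add_comm]

/-! ### Two-sided compressions and the sum over the primes -/

theorem mem_contiguousMatrices {m n : ℕ} {a : ℤ} {S : ℕ} {B : Matrix (Fin m) (Fin n) ℤ} :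
    B ∈ contiguousMatrices m n a S ↔ ∀ i j, B i j ∈ Finset.Ico a (a + S) :=
  Fintype.mem_piFinset.trans (forall_congr' fun _ => Fintype.mem_piFinset)

theorem expect_contiguousMatrices_transpose (m n : ℕ) (a : ℤ) (S : ℕ)
    (f : Matrix (Fin m) (Fin n) ℤ → ℝ) :
    (contiguousMatrices m n a S).expect f =
      (contiguousMatrices n m a S).expect fun C => f C.transpose := by
  refine Finset.expect_nbij' Matrix.transpose Matrix.transpose ?_ ?_ ?_ ?_ ?_
  · exact fun B hB => mem_contiguousMatrices.2 fun i j => mem_contiguousMatrices.1 hB j i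
  · exact fun B hB => mem_contiguousMatrices.2 fun i j => mem_contiguousMatrices.1 hB j i
  · intro B _; rfl
  · intro B _; rfl
  · intro B _; rfl

theorem contiguousMatrices_nonempty (m n : ℕ) (a : ℤ) {S : ℕ} (hS : S ≠ 0) :
    (contiguousMatrices m n a S).Nonempty := by
  refine Fintype.piFinset_nonempty.2 fun _ => Fintype.piFinset_nonempty.2 fun _ => ?_
  rw [Finset.nonempty_Ico]
  omega

theorem Matrix.submatrix_castLE_mul_inv {k n : ℕ} (h : k ≤ n) (V : Matrix (Fin n) (Fin n) ℤ)
    (hV : IsUnit V.det) :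
    V.submatrix (Fin.castLE h) id * V⁻¹.submatrix id (Fin.castLE h) = 1 := by
  rw [← Matrix.submatrix_mul _ _ _ _ _ Function.bijective_id, Matrix.mul_nonsing_inv _ hV,
    Matrix.submatrix_one _ (Fin.castLE_injective h)]

/-- If `μ` is the product of the first `k` entries of `d`, the `k × k` compressions of
`U * diag(d) * V` by a fixed left factor `R` have determinants which, divided by `μ`, divide a
constant times `det (W * B)` with `W` right invertible; the constant is the determinant of `R`
times the first `k` columns of `U`. -/
theorem Matrix.exists_det_compression_dvd {k n : ℕ} (h : k ≤ n) (U V : Matrix (Fin n) (Fin n) ℤ)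
    (hV : IsUnit V.det) (d : Fin n → ℕ) (hd : ∏ i, d (Fin.castLE h i) ≠ 0)
    (R : Matrix (Fin k) (Fin n) ℤ) :
    ∃ (W : Matrix (Fin k) (Fin n) ℤ) (X : Matrix (Fin n) (Fin k) ℤ), W * X = 1 ∧
      ∀ (B : Matrix (Fin n) (Fin k) ℤ) (F : ℤ),
        ((∏ i, d (Fin.castLE h i) : ℕ) : ℤ) * F =
          (R * (U * Matrix.diagonal (fun i => (d i : ℤ)) * V) * B).det →
        F ∣ (R * U.submatrix id (Fin.castLE h)).det * (W * B).det := by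
  set D := Matrix.diagonal fun i => (d i : ℤ) with hD
  obtain ⟨T, V', hV', hN⟩ := Matrix.exists_mul_unimodular_rows h (R * (U * D * V))
  refine ⟨V'.submatrix (Fin.castLE h) id, _, Matrix.submatrix_castLE_mul_inv h V' hV', ?_⟩
  intro B F hF
  set W := V'.submatrix (Fin.castLE h) id
  have h1 : (R * U * D).submatrix id (Fin.castLE h) =
      T * (W * V⁻¹).submatrix id (Fin.castLE h) := by
    have h2 : R * U * D = T * W * V⁻¹ := by
      rw [← hN, ← Matrix.mul_assoc, ← Matrix.mul_assoc, Matrix.mul_nonsing_inv_cancel_right _ _ hV]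
    rw [h2, Matrix.mul_assoc T, Matrix.submatrix_mul T _ id id _ Function.bijective_id,
      Matrix.submatrix_id_id]
  have h3 : (R * U * D).submatrix id (Fin.castLE h) = R * U.submatrix id (Fin.castLE h) *
      Matrix.diagonal fun i => (d (Fin.castLE h i) : ℤ) := by
    ext i j
    rw [Matrix.submatrix_apply, hD, Matrix.mul_diagonal, Matrix.mul_diagonal]
    rfl
  -- The first `k` columns show that `det T` divides `μ` times the constant.
  have h4 : T.det ∣ (R * U.submatrix id (Fin.castLE h)).det *
      ((∏ i, d (Fin.castLE h i) : ℕ) : ℤ) := by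
    have h5 := congrArg Matrix.det (h3.symm.trans h1)
    rw [Matrix.det_mul, Matrix.det_mul T, Matrix.det_diagonal] at h5
    push_cast
    rw [h5]
    exact dvd_mul_right _ _
  rw [hN, Matrix.mul_assoc T, Matrix.det_mul] at hF
  have hd' : ((∏ i, d (Fin.castLE h i) : ℕ) : ℤ) ≠ 0 := by exact_mod_cast hd
  refine (mul_dvd_mul_iff_left hd').1 ?_
  rw [hF, ← mul_assoc, mul_comm (((∏ i, d (Fin.castLE h i) : ℕ) : ℤ))]
  exact mul_dvd_mul_right h4 _

/-- The expected truncated valuation of the normalized determinant of a random two-sided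
compression is at most twice that of `det (W * B)` for a right invertible `W`. -/
theorem expect_expect_logGcd_le {k n : ℕ} (h : k ≤ n) (U V : Matrix (Fin n) (Fin n) ℤ)
    (hU : IsUnit U.det) (hV : IsUnit V.det) (d : Fin n → ℕ) (hd : ∏ i, d (Fin.castLE h i) ≠ 0)
    (F : Matrix (Fin k) (Fin n) ℤ → Matrix (Fin n) (Fin k) ℤ → ℤ)
    (hF : ∀ R B, ((∏ i, d (Fin.castLE h i) : ℕ) : ℤ) * F R B =
      (R * (U * Matrix.diagonal (fun i => (d i : ℤ)) * V) * B).det)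
    {p : ℕ} (hp : p.Prime) (K : ℕ) (a : ℤ) {S : ℕ} (hS : S ≠ 0) :
    ((contiguousMatrices k n a S).expect fun R => (contiguousMatrices n k a S).expect fun B =>
      logGcd (F R B) (p ^ K)) ≤
      2 * (Real.log p * ∑ m ∈ Finset.Icc 1 K, ∑ c ∈ Finset.Icc 1 k, (1 / (p : ℝ) ^ m + 1 / S) ^ c) := by
  have hP : p ^ K ≠ 0 := pow_ne_zero _ hp.ne_zero
  set Φ := Real.log p * ∑ m ∈ Finset.Icc 1 K, ∑ c ∈ Finset.Icc 1 k, (1 / (p : ℝ) ^ m + 1 / S) ^ c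
  have hone : ∀ (W : Matrix (Fin k) (Fin n) ℤ) (X : Matrix (Fin n) (Fin k) ℤ), W * X = 1 →
      ((contiguousMatrices k n a S).expect fun C => logGcd (W * C.transpose).det (p ^ K)) ≤ Φ := by
    intro W X hWX
    refine expect_logGcd_det_mul_le W X hWX hp K (Finset.Ico a (a + S)) ?_
      (fun m => 1 / (p : ℝ) ^ m + 1 / S) fun m r => ?_
    · rw [Finset.nonempty_Ico]; omega
    · have := card_Ico_filter_modEq_le a r S (p ^ m) hS (pow_ne_zero _ hp.ne_zero)
      push_cast at this ⊢
      exact this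
  set Y := U.submatrix id (Fin.castLE h) with hY
  have hR : ((contiguousMatrices k n a S).expect fun R => logGcd (R * Y).det (p ^ K)) ≤ Φ := by
    refine le_of_eq_of_le ?_ (hone Y.transpose (U⁻¹.submatrix (Fin.castLE h) id).transpose ?_)
    · refine Finset.expect_congr rfl fun R _ => ?_
      rw [← Matrix.transpose_mul, Matrix.det_transpose]
    · rw [← Matrix.transpose_mul, hY,
        ← Matrix.submatrix_mul _ _ _ _ _ Function.bijective_id, Matrix.nonsing_inv_mul _ hU,
        Matrix.submatrix_one _ (Fin.castLE_injective h), Matrix.transpose_one]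
  have hB : ∀ R, ((contiguousMatrices n k a S).expect fun B => logGcd (F R B) (p ^ K)) ≤
      logGcd (R * Y).det (p ^ K) + Φ := by
    intro R
    obtain ⟨W, X, hWX, hdvd⟩ := Matrix.exists_det_compression_dvd h U V hV d hd R
    calc _ ≤ (contiguousMatrices n k a S).expect fun B =>
          (logGcd (R * Y).det (p ^ K) + logGcd (W * B).det (p ^ K)) :=
          Finset.expect_le_expect fun B _ =>
            (logGcd_le_of_dvd hP (hdvd B _ (hF R B))).trans (logGcd_mul_le _ _ hP)
      _ ≤ _ := by
          rw [Finset.expect_add_distrib, Finset.expect_const (contiguousMatrices_nonempty _ _ _ hS),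
            expect_contiguousMatrices_transpose n k]
          exact add_le_add le_rfl (hone W X hWX)
  refine (Finset.expect_le_expect fun R _ => hB R).trans ?_
  rw [Finset.expect_add_distrib, Finset.expect_const (contiguousMatrices_nonempty _ _ _ hS), two_mul]
  exact add_le_add hR le_rfl

theorem sum_Icc_one_pow_le {x : ℝ} (h0 : 0 ≤ x) (h1 : x < 1) (k : ℕ) :
    ∑ c ∈ Finset.Icc 1 k, x ^ c ≤ x / (1 - x) := by
  have h2 : ∑ c ∈ Finset.Icc 1 k, x ^ c = x * ∑ c ∈ Finset.range k, x ^ c := by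
    rw [Finset.mul_sum, Finset.range_eq_Ico, ← Finset.Ico_add_one_right_eq_Icc,
      ← Finset.sum_Ico_add' (fun c => x ^ c) 0 k 1]
    exact Finset.sum_congr rfl fun c _ => by rw [pow_succ, mul_comm]
  rw [h2, div_eq_mul_inv]
  refine mul_le_mul_of_nonneg_left ?_ h0
  rw [← tsum_geometric_of_lt_one h0 h1]
  exact (summable_geometric_of_lt_one h0 h1).sum_le_tsum _ fun _ _ => pow_nonneg h0 _

/-- For `S ≥ 4` the ratios `1 / p ^ m + 1 / S` are at most `3 / 4`, so that the geometric sums are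
at most four times their first terms. -/
theorem sum_sum_pow_le {p S : ℕ} (hp : p.Prime) (hS : 4 ≤ S) (k K : ℕ) :
    ∑ m ∈ Finset.Icc 1 K, ∑ c ∈ Finset.Icc 1 k, (1 / (p : ℝ) ^ m + 1 / S) ^ c ≤
      4 * (2 / p + K / S) := by
  have hp2 : (2 : ℝ) ≤ p := by exact_mod_cast hp.two_le
  have hS4 : (4 : ℝ) ≤ S := by exact_mod_cast hS
  have hSinv : 1 / (S : ℝ) ≤ 1 / 4 := one_div_le_one_div_of_le (by norm_num) hS4
  have hpinv : 1 / (p : ℝ) ≤ 1 / 2 := one_div_le_one_div_of_le (by norm_num) hp2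
  have hp0 : (0 : ℝ) < 1 / p := by positivity
  have h1 : ∀ m ∈ Finset.Icc 1 K, ∑ c ∈ Finset.Icc 1 k, (1 / (p : ℝ) ^ m + 1 / S) ^ c ≤
      4 * ((1 / (p : ℝ)) ^ m + 1 / S) := by
    intro m hm
    have h2 : 1 / (p : ℝ) ^ m ≤ 1 / 2 := by
      rw [← one_div_pow]
      exact (pow_le_of_le_one hp0.le (by linarith) (by have := (Finset.mem_Icc.1 hm).1; omega)).trans
        hpinv
    rw [one_div_pow]
    have h3 : 0 ≤ 1 / (p : ℝ) ^ m + 1 / S := by positivity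
    refine (sum_Icc_one_pow_le h3 (by linarith) k).trans ?_
    rw [div_le_iff₀ (by linarith)]
    nlinarith
  refine (Finset.sum_le_sum h1).trans ?_
  rw [← Finset.mul_sum, Finset.sum_add_distrib]
  have h4 : ∑ m ∈ Finset.Icc 1 K, (1 / (p : ℝ)) ^ m ≤ 2 / p := by
    refine (sum_Icc_one_pow_le hp0.le (by linarith) K).trans ?_
    rw [div_le_iff₀ (by linarith), show (2 : ℝ) / p = 2 * (1 / p) by ring]
    nlinarith
  have h5 : ∑ _m ∈ Finset.Icc 1 K, 1 / (S : ℝ) = K / S := by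
    rw [Finset.sum_const, Nat.card_Icc, nsmul_eq_mul]
    simp [div_eq_mul_inv]
  rw [h5]
  linarith

/-- At each prime, a common divisor of `x` and `y` is controlled by the event `p ∣ x` together with
the valuation of `y`. This makes the contribution of `p` quadratic in `1 / p`. -/
theorem log_mul_logGcd_gcd_le (x y : ℤ) {p : ℕ} (hp : p.Prime) (K : ℕ) :
    Real.log p * logGcd (Int.gcd x y) (p ^ K) ≤ logGcd x (p ^ 1) * logGcd y (p ^ K) := by
  have hP : p ^ K ≠ 0 := pow_ne_zero _ hp.ne_zero
  rw [pow_one]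
  by_cases h : p ∣ x.natAbs
  · have h1 : logGcd x p = Real.log p := by rw [logGcd, Nat.gcd_eq_right h]
    rw [h1]
    exact mul_le_mul_of_nonneg_left (logGcd_le_of_dvd hP (Int.gcd_dvd_right x y))
      (Real.log_natCast_nonneg _)
  · have h1 : logGcd (Int.gcd x y) (p ^ K) = 0 := by
      have h2 : Nat.gcd x.natAbs (p ^ K) = 1 :=
        ((Nat.coprime_comm.1 ((Nat.Prime.coprime_iff_not_dvd hp).2 h))).pow_right K
      have h3 := logGcd_le_of_dvd hP (Int.gcd_dvd_left x y)
      have h4 : logGcd x (p ^ K) = 0 := by rw [logGcd, h2]; simp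
      exact le_antisymm (h4 ▸ h3) (logGcd_nonneg _ _)
    rw [h1, mul_zero]
    exact mul_nonneg (logGcd_nonneg _ _) (logGcd_nonneg _ _)

theorem logGcd_le_sum_primeFactors (x : ℤ) {N : ℕ} (hN : N ≠ 0) :
    logGcd x N ≤ ∑ p ∈ N.primeFactors, logGcd x (p ^ N.factorization p) := by
  have key : ∀ s : Finset ℕ, s ⊆ N.primeFactors →
      x.natAbs.gcd (∏ p ∈ s, p ^ N.factorization p) ∣
        ∏ p ∈ s, x.natAbs.gcd (p ^ N.factorization p) := by
    intro s
    induction s using Finset.induction_on with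
    | empty => simp
    | insert p s hps ih =>
      intro hs
      rw [Finset.prod_insert hps, Finset.prod_insert hps]
      exact (Nat.gcd_mul_right_dvd_mul_gcd _ _ _).trans
        (mul_dvd_mul_left _ (ih ((Finset.subset_insert _ _).trans hs)))
  have h1 := key _ subset_rfl
  have h2 : ∏ p ∈ N.primeFactors, p ^ N.factorization p = N :=
    Nat.prod_factorization_pow_eq_self hN
  rw [h2] at h1
  have hpos : ∀ p ∈ N.primeFactors, 0 < x.natAbs.gcd (p ^ N.factorization p) := fun p hp =>
    Nat.gcd_pos_of_pos_right _ (pow_pos (Nat.prime_of_mem_primeFactors hp).pos _)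
  simp only [logGcd]
  rw [← Real.log_prod fun p hp => by exact_mod_cast (hpos p hp).ne']
  refine Real.log_le_log (by exact_mod_cast Nat.gcd_pos_of_pos_right _ (Nat.pos_of_ne_zero hN)) ?_
  exact_mod_cast Nat.le_of_dvd (Finset.prod_pos hpos) h1

theorem exists_forall_sum_log_div_sq_le :
    ∃ C : ℝ, ∀ s : Finset ℕ, ∑ n ∈ s, Real.log n / (n : ℝ) ^ 2 ≤ C := by
  have hsum : Summable fun n : ℕ => 2 * (1 / (n : ℝ) ^ (3 / 2 : ℝ)) :=
    (Real.summable_one_div_nat_rpow.2 (by norm_num)).mul_left 2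
  refine ⟨∑' n : ℕ, 2 * (1 / (n : ℝ) ^ (3 / 2 : ℝ)), fun s => ?_⟩
  refine (Finset.sum_le_sum fun n _ => ?_).trans
    (hsum.sum_le_tsum s fun n _ => by positivity)
  rcases Nat.eq_zero_or_pos n with rfl | hn
  · norm_num
  have hn' : (0 : ℝ) < n := by exact_mod_cast hn
  -- `log n ≤ 2 * n ^ (1 / 2)` leaves the convergent series of `2 / n ^ (3 / 2)`.
  have h1 := Real.log_le_rpow_div hn'.le (ε := 1 / 2) (by norm_num)
  have h2 : (n : ℝ) ^ 2 = (n : ℝ) ^ (1 / 2 : ℝ) * (n : ℝ) ^ (3 / 2 : ℝ) := by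
    rw [← Real.rpow_add hn', ← Real.rpow_natCast]
    norm_num
  have h3 : 0 < (n : ℝ) ^ (1 / 2 : ℝ) := by positivity
  have h4 : 0 < (n : ℝ) ^ (3 / 2 : ℝ) := by positivity
  calc Real.log n / (n : ℝ) ^ 2 ≤ ((n : ℝ) ^ (1 / 2 : ℝ) / (1 / 2)) / (n : ℝ) ^ 2 := by gcongr
    _ = 2 * (1 / (n : ℝ) ^ (3 / 2 : ℝ)) := by rw [h2]; field_simp

/-- Summing the contributions of the primes dividing `N`. The pair `(R₁, B₁)` contributes the
probability that `p` divides the normalized determinant and the independent pair `(R₂, B₂)` the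
expected truncated valuation. -/
theorem exists_expect_logGcd_gcd_le : ∃ C : ℝ, ∀ {k n : ℕ} (h : k ≤ n)
    (U V : Matrix (Fin n) (Fin n) ℤ) (_ : IsUnit U.det) (_ : IsUnit V.det) (d : Fin n → ℕ)
    (_ : ∏ i, d (Fin.castLE h i) ≠ 0)
    (F : Matrix (Fin k) (Fin n) ℤ → Matrix (Fin n) (Fin k) ℤ → ℤ)
    (_ : ∀ R B, ((∏ i, d (Fin.castLE h i) : ℕ) : ℤ) * F R B =
      (R * (U * Matrix.diagonal (fun i => (d i : ℤ)) * V) * B).det)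
    {N : ℕ} (_ : N ≠ 0) (a : ℤ) {S : ℕ} (_ : 4 ≤ S),
    ((contiguousMatrices n k a S).expect fun B₁ => (contiguousMatrices n k a S).expect fun B₂ =>
      (contiguousMatrices k n a S).expect fun R₁ => (contiguousMatrices k n a S).expect fun R₂ =>
        logGcd (Int.gcd (F R₁ B₁) (F R₂ B₂)) N) ≤ C + 192 * (Real.log N / S) := by
  obtain ⟨C, hC⟩ := exists_forall_sum_log_div_sq_le
  refine ⟨256 * C, ?_⟩
  intro k n h U V hU hV d hd F hF N hN a S hS
  have hS0 : S ≠ 0 := by omega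
  have hone : ∀ {p : ℕ}, p.Prime → ∀ K : ℕ,
      ((contiguousMatrices n k a S).expect fun B => (contiguousMatrices k n a S).expect fun R =>
        logGcd (F R B) (p ^ K)) ≤ 8 * Real.log p * (2 / p + K / S) := by
    intro p hp K
    rw [Finset.expect_comm]
    refine (expect_expect_logGcd_le h U V hU hV d hd F hF hp K a hS0).trans ?_
    have h1 := mul_le_mul_of_nonneg_left (sum_sum_pow_le hp hS k K) (Real.log_natCast_nonneg p)
    linarith
  have hnn : ∀ P : ℕ, 0 ≤ (contiguousMatrices n k a S).expect fun B =>
      (contiguousMatrices k n a S).expect fun R => logGcd (F R B) P := fun P =>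
    Finset.expect_nonneg fun B _ => Finset.expect_nonneg fun R _ => logGcd_nonneg _ _
  have hpair : ∀ p ∈ N.primeFactors,
      ((contiguousMatrices n k a S).expect fun B₁ => (contiguousMatrices n k a S).expect fun B₂ =>
      (contiguousMatrices k n a S).expect fun R₁ => (contiguousMatrices k n a S).expect fun R₂ =>
        logGcd (Int.gcd (F R₁ B₁) (F R₂ B₂)) (p ^ N.factorization p)) ≤
      256 * (Real.log p / (p : ℝ) ^ 2) + 192 * (N.factorization p * Real.log p / S) := by
    intro p hpN
    have hp := Nat.prime_of_mem_primeFactors hpN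
    set K := N.factorization p with hK
    have hK1 : 1 ≤ K := hp.factorization_pos_of_dvd hN (Nat.dvd_of_mem_primeFactors hpN)
    have hlog : 0 < Real.log p := Real.log_pos (by exact_mod_cast hp.one_lt)
    -- The two independent pairs separate: the event `p ∣ F R₁ B₁` and the valuation of `F R₂ B₂`.
    have h1 : (Real.log p * (contiguousMatrices n k a S).expect fun B₁ =>
        (contiguousMatrices n k a S).expect fun B₂ =>
        (contiguousMatrices k n a S).expect fun R₁ => (contiguousMatrices k n a S).expect fun R₂ =>
          logGcd (Int.gcd (F R₁ B₁) (F R₂ B₂)) (p ^ K)) ≤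
        (8 * Real.log p * (2 / p + (1 : ℕ) / S)) * (8 * Real.log p * (2 / p + K / S)) := by
      refine le_trans ?_ (mul_le_mul (hone hp 1) (hone hp K) (hnn _) ((hnn _).trans (hone hp 1)))
      rw [Finset.expect_mul_expect, Finset.mul_expect]
      refine Finset.expect_le_expect fun B₁ _ => ?_
      rw [Finset.mul_expect]
      refine Finset.expect_le_expect fun B₂ _ => ?_
      rw [Finset.expect_mul_expect, Finset.mul_expect]
      refine Finset.expect_le_expect fun R₁ _ => ?_
      rw [Finset.mul_expect]
      exact Finset.expect_le_expect fun R₂ _ => log_mul_logGcd_gcd_le _ _ hp K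
    have hpinv : (1 : ℝ) / p ≤ 1 / 2 :=
      one_div_le_one_div_of_le (by norm_num) (by exact_mod_cast hp.two_le)
    have hSinv : (1 : ℝ) / S ≤ 1 / 4 :=
      one_div_le_one_div_of_le (by norm_num) (by exact_mod_cast hS)
    have hp0 : (0 : ℝ) ≤ 1 / p := by positivity
    have hS0' : (0 : ℝ) ≤ 1 / S := by positivity
    have hKr : (1 : ℝ) ≤ K := by exact_mod_cast hK1
    have h2 : ((2 : ℝ) / p + (1 : ℕ) / S) * (2 / p + K / S) ≤ 4 * (1 / p) ^ 2 + 3 * (K * (1 / S)) := by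
      set u := (1 : ℝ) / p
      set v := (1 : ℝ) / S
      have e1 : (2 : ℝ) / p = 2 * u := by simp only [u]; ring
      have e2 : ((1 : ℕ) : ℝ) / S = v := by simp [v]
      have e3 : (K : ℝ) / S = K * v := by simp only [v]; ring
      rw [e1, e2, e3]
      have hKv : v ≤ K * v := le_mul_of_one_le_left hS0' hKr
      have f1 : u * (K * v) ≤ 1 / 2 * (K * v) := mul_le_mul_of_nonneg_right hpinv (by positivity)
      have f2 : u * v ≤ 1 / 2 * v := mul_le_mul_of_nonneg_right hpinv hS0'
      have f3 : v * (K * v) ≤ 1 / 4 * (K * v) := mul_le_mul_of_nonneg_right hSinv (by positivity)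
      nlinarith
    refine le_of_mul_le_mul_left (h1.trans ?_) hlog
    have h3 := mul_le_mul_of_nonneg_left h2 (by positivity : (0 : ℝ) ≤ 64 * (Real.log p * Real.log p))
    refine le_trans (le_of_eq (by ring)) (h3.trans (le_of_eq (by ring)))
  calc _ ≤ (contiguousMatrices n k a S).expect fun B₁ =>
        (contiguousMatrices n k a S).expect fun B₂ =>
        (contiguousMatrices k n a S).expect fun R₁ => (contiguousMatrices k n a S).expect fun R₂ =>
          ∑ p ∈ N.primeFactors, logGcd (Int.gcd (F R₁ B₁) (F R₂ B₂)) (p ^ N.factorization p) :=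
        Finset.expect_le_expect fun B₁ _ => Finset.expect_le_expect fun B₂ _ =>
          Finset.expect_le_expect fun R₁ _ => Finset.expect_le_expect fun R₂ _ =>
            logGcd_le_sum_primeFactors _ hN
    _ ≤ ∑ p ∈ N.primeFactors, (256 * (Real.log p / (p : ℝ) ^ 2) +
          192 * (N.factorization p * Real.log p / S)) := by
        simp only [Finset.expect_sum_comm]
        exact Finset.sum_le_sum hpair
    _ ≤ _ := by
        rw [Finset.sum_add_distrib, ← Finset.mul_sum, ← Finset.mul_sum, ← Finset.sum_div,
          Real.log_nat_eq_sum_factorization N]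
        have h1 := hC N.primeFactors
        have h2 : (N.factorization.sum fun p t => (t : ℝ) * Real.log p) =
          ∑ p ∈ N.primeFactors, (N.factorization p : ℝ) * Real.log p := rfl
        rw [h2]
        linarith

/-! ### Invariant factors and the Hadamard bound -/

theorem invariantFactor_succ_eq {n : ℕ} (A : Matrix (Fin n) (Fin n) ℤ) (i : Fin n) :
    invariantFactor A (i + 1) = (exists_isSmithForm A).choose i := by
  rw [invariantFactor, dif_pos ⟨by omega, by omega⟩]
  rfl

theorem IsSmithForm.natAbs_det {n : ℕ} {A : Matrix (Fin n) (Fin n) ℤ} {s : Fin n → ℕ}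
    (h : IsSmithForm A s) : A.det.natAbs = ∏ i, s i := by
  obtain ⟨-, U, V, hU, hV, rfl⟩ := h
  rw [Matrix.det_mul, Matrix.det_mul, Matrix.det_diagonal, Int.natAbs_mul, Int.natAbs_mul,
    Int.isUnit_iff_natAbs_eq.1 hU, Int.isUnit_iff_natAbs_eq.1 hV, one_mul, mul_one,
    ← Nat.cast_prod, Int.natAbs_natCast]

theorem smallInvariantProduct_self {k : ℕ} (X : Matrix (Fin k) (Fin k) ℤ) :
    smallInvariantProduct k X = X.det.natAbs := by
  rw [(exists_isSmithForm X).choose_spec.natAbs_det, smallInvariantProduct,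
    ← Finset.Ico_add_one_right_eq_Icc,
    ← Finset.prod_Ico_add' (fun i => invariantFactor X i) 0 k 1, ← Finset.range_eq_Ico,
    ← Fin.prod_univ_eq_prod_range (fun i => invariantFactor X (i + 1)) k]
  exact Finset.prod_congr rfl fun i _ => invariantFactor_succ_eq X i

theorem largeInvariantProduct_eq {n k : ℕ} (h : k ≤ n) (A : Matrix (Fin n) (Fin n) ℤ) :
    largeInvariantProduct k A =
      ∏ i : Fin k, (exists_isSmithForm A).choose (Fin.rev (Fin.castLE h i)) := by
  rw [largeInvariantProduct]
  symm
  refine Finset.prod_bij (fun i _ => n - i) ?_ ?_ ?_ ?_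
  · intro i _
    rw [Finset.mem_Icc]
    omega
  · intro i _ j _ hij
    ext
    omega
  · intro j hj
    rw [Finset.mem_Icc] at hj
    exact ⟨⟨n - j, by omega⟩, Finset.mem_univ _, by simp; omega⟩
  · intro i _
    rw [← invariantFactor_succ_eq]
    congr 1
    simp only [Fin.val_rev, Fin.val_castLE]
    omega

/-- The determinant is at most the square of the Hadamard bound; this weak form already follows
from the Leibniz formula. -/
theorem natAbs_det_le_hadamardBound_sq {n : ℕ} (A : Matrix (Fin n) (Fin n) ℤ) (hA : A.det ≠ 0) :
    (A.det.natAbs : ℝ) ≤ hadamardBound A ^ 2 := by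
  have h1 : |A.det| ≤ n.factorial • (maxAbsEntry A : ℤ) ^ n := by
    have := Matrix.det_le (A := A) (abv := AbsoluteValue.abs) (x := (maxAbsEntry A : ℤ)) fun i j => by
      rw [AbsoluteValue.abs_apply, Int.abs_eq_natAbs]
      exact_mod_cast (Finset.le_sup (f := fun j => (A i j).natAbs) (Finset.mem_univ j)).trans
        (Finset.le_sup (f := fun i => Finset.univ.sup fun j => (A i j).natAbs) (Finset.mem_univ i))
    simpa using this
  have h2 : A.det.natAbs ≤ n.factorial * maxAbsEntry A ^ n := by
    rw [Int.abs_eq_natAbs, nsmul_eq_mul] at h1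
    exact_mod_cast h1
  have hpos : 1 ≤ maxAbsEntry A ^ n := by
    by_contra h0
    have h3 : maxAbsEntry A ^ n = 0 := by omega
    rw [h3, mul_zero] at h2
    exact hA (Int.natAbs_eq_zero.1 (by omega))
  have h4 : A.det.natAbs ≤ n ^ n * (maxAbsEntry A ^ n * maxAbsEntry A ^ n) :=
    h2.trans (Nat.mul_le_mul (Nat.factorial_le_pow n) (Nat.le_mul_of_pos_left _ hpos))
  have h5 : hadamardBound A ^ 2 = (n : ℝ) ^ n * ((maxAbsEntry A : ℝ) ^ n * (maxAbsEntry A : ℝ) ^ n) := by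
    rw [hadamardBound, ← pow_mul, mul_comm n 2, pow_mul, mul_pow, Real.sq_sqrt (Nat.cast_nonneg _)]
    ring
  rw [h5]
  exact_mod_cast h4

theorem log_two_le_log_hadamardBound {n : ℕ} (hn : 2 ≤ n) (A : Matrix (Fin n) (Fin n) ℤ)
    (hA : A ≠ 0) : Real.log 2 ≤ Real.log (hadamardBound A) := by
  have h1 : 1 ≤ maxAbsEntry A := by
    by_contra h0
    refine hA (Matrix.ext fun i j => Int.natAbs_eq_zero.1 (Nat.le_zero.1 ?_))
    calc (A i j).natAbs ≤ maxAbsEntry A :=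
          (Finset.le_sup (f := fun j => (A i j).natAbs) (Finset.mem_univ j)).trans
          (Finset.le_sup (f := fun i => Finset.univ.sup fun j => (A i j).natAbs) (Finset.mem_univ i))
      _ ≤ 0 := by omega
  refine Real.log_le_log (by norm_num) ?_
  have h2 : Real.sqrt 2 ≤ Real.sqrt n * maxAbsEntry A := by
    have h3 : Real.sqrt 2 ≤ Real.sqrt n := Real.sqrt_le_sqrt (by exact_mod_cast hn)
    exact h3.trans (le_mul_of_one_le_right (Real.sqrt_nonneg _) (by exact_mod_cast h1))
  calc (2 : ℝ) = Real.sqrt 2 ^ 2 := (Real.sq_sqrt (by norm_num)).symm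
    _ ≤ (Real.sqrt n * maxAbsEntry A) ^ 2 := by gcongr
    _ ≤ hadamardBound A := by
        refine pow_le_pow_right₀ (le_trans ?_ h2) hn
        exact Real.one_le_sqrt.2 (by norm_num)

/-- Smith form of the scaled inverse: `M = s_n A⁻¹` is unimodularly equivalent to
the diagonal matrix of the reversed quotients `d_i = s_n / s_{n + 1 - i}`. -/
theorem exists_inverse_smithForm {n : ℕ} (hn : 0 < n) (A : Matrix (Fin n) (Fin n) ℤ)
    (hA : A.det ≠ 0) :
    ∃ (U V : Matrix (Fin n) (Fin n) ℤ) (d : Fin n → ℕ), IsUnit U.det ∧ IsUnit V.det ∧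
      (∀ i j, i ≤ j → d i ∣ d j) ∧
      (∀ i, d i * (exists_isSmithForm A).choose (Fin.rev i) = invariantFactor A n) ∧
      (U * Matrix.diagonal (fun i => (d i : ℤ)) * V).map (Int.cast : ℤ → ℚ) =
        (invariantFactor A n : ℚ) • (A.map (Int.cast : ℤ → ℚ))⁻¹ := by
  obtain ⟨hs, P, Q, hP, hQ, hPQ⟩ := (exists_isSmithForm A).choose_spec
  have hdet := (exists_isSmithForm A).choose_spec.natAbs_det
  have hlast : invariantFactor A n = (exists_isSmithForm A).choose ⟨n - 1, by omega⟩ := by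
    rw [← invariantFactor_succ_eq]
    congr 1
    simp only
    omega
  set s := (exists_isSmithForm A).choose
  set N := invariantFactor A n
  have hs0 : ∀ i, s i ≠ 0 := fun i h0 => by
    rw [Finset.prod_eq_zero (Finset.mem_univ i) h0] at hdet
    exact hA (Int.natAbs_eq_zero.1 hdet)
  have hsN : ∀ i, s i ∣ N := fun i => by
    rw [hlast]
    exact hs _ _ (Fin.le_def.2 (by simp only; omega))
  have hmul : ∀ i, N / s i * s i = N := fun i => Nat.div_mul_cancel (hsN i)
  let d : Fin n → ℕ := fun i => N / s (Fin.rev i)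
  let σ : Equiv.Perm (Fin n) := Fin.revPerm
  have hunit : ∀ X : Matrix (Fin n) (Fin n) ℤ, IsUnit X.det → IsUnit (X⁻¹).det := fun X hX =>
    Matrix.isUnit_nonsing_inv_det _ hX
  have hM : Q⁻¹.submatrix id σ * Matrix.diagonal (fun i => (d i : ℤ)) * P⁻¹.submatrix σ id =
      Q⁻¹ * Matrix.diagonal (fun i => ((N / s i : ℕ) : ℤ)) * P⁻¹ := by
    have h1 : Matrix.diagonal (fun i => (d i : ℤ)) =
        (Matrix.diagonal (fun i => ((N / s i : ℕ) : ℤ))).submatrix σ σ := by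
      rw [Matrix.submatrix_diagonal_equiv]
      rfl
    rw [h1, Matrix.submatrix_mul_equiv, Matrix.submatrix_mul_equiv, Matrix.submatrix_id_id]
  refine ⟨Q⁻¹.submatrix id σ, P⁻¹.submatrix σ id, d, ?_, ?_, ?_, fun i => hmul _, ?_⟩
  · rw [Matrix.det_permute']
    exact (Units.isUnit _).map (Int.castRingHom ℤ) |>.mul (hunit Q hQ)
  · rw [Matrix.det_permute]
    exact (Units.isUnit _).map (Int.castRingHom ℤ) |>.mul (hunit P hP)
  · intro i j hij
    exact Nat.div_dvd_div_left (hsN _) (hs _ _ (Fin.rev_le_rev.2 hij))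
  · rw [hM]
    have h1 : (Q⁻¹ * Matrix.diagonal (fun i => ((N / s i : ℕ) : ℤ)) * P⁻¹) * A =
        (N : ℤ) • (1 : Matrix (Fin n) (Fin n) ℤ) := by
      have h2 : Matrix.diagonal (fun i => ((N / s i : ℕ) : ℤ)) * Matrix.diagonal (fun i => (s i : ℤ)) =
          (N : ℤ) • (1 : Matrix (Fin n) (Fin n) ℤ) := by
        rw [Matrix.diagonal_mul_diagonal, ← Matrix.diagonal_one, ← Matrix.diagonal_smul]
        congr 1
        ext i
        rw [Pi.smul_apply, smul_eq_mul, mul_one]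
        exact_mod_cast hmul i
      rw [hPQ, Matrix.mul_assoc, ← Matrix.mul_assoc P⁻¹, ← Matrix.mul_assoc P⁻¹,
        Matrix.nonsing_inv_mul _ hP, Matrix.one_mul, Matrix.mul_assoc,
        ← Matrix.mul_assoc (Matrix.diagonal _) (Matrix.diagonal _), h2, Matrix.smul_mul,
        Matrix.one_mul, Matrix.mul_smul, Matrix.nonsing_inv_mul _ hQ]
    set M := Q⁻¹ * Matrix.diagonal (fun i => ((N / s i : ℕ) : ℤ)) * P⁻¹
    have h3 : M.map (Int.cast : ℤ → ℚ) * A.map (Int.cast : ℤ → ℚ) = (N : ℚ) • 1 := by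
      have h4 : (M * A).map (Int.cast : ℤ → ℚ) = M.map (Int.cast : ℤ → ℚ) * A.map (Int.cast : ℤ → ℚ) :=
        Matrix.map_mul (f := Int.castRingHom ℚ)
      rw [← h4, h1]
      ext i j
      simp only [Matrix.map_apply, Matrix.smul_apply, Matrix.one_apply, smul_eq_mul]
      split_ifs <;> simp
    have h5 : IsUnit (A.map (Int.cast : ℤ → ℚ)).det := by
      have h6 : (A.map (Int.cast : ℤ → ℚ)).det = (A.det : ℚ) :=
        ((Int.castRingHom ℚ).map_det A).symm
      rw [h6]
      exact (Int.cast_ne_zero.2 hA).isUnit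
    calc M.map (Int.cast : ℤ → ℚ)
        = M.map (Int.cast : ℤ → ℚ) * A.map (Int.cast : ℤ → ℚ) * (A.map (Int.cast : ℤ → ℚ))⁻¹ :=
          (Matrix.mul_nonsing_inv_cancel_right _ _ h5).symm
      _ = _ := by rw [h3, Matrix.smul_mul, Matrix.one_mul]

theorem largeInvariantProduct_dvd_natAbs_det {n k : ℕ} (h : k ≤ n) (A : Matrix (Fin n) (Fin n) ℤ) :
    largeInvariantProduct k A ∣ A.det.natAbs := by
  rw [(exists_isSmithForm A).choose_spec.natAbs_det, largeInvariantProduct_eq h]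
  rw [← Finset.prod_image (s := Finset.univ) (g := fun i : Fin k => Fin.rev (Fin.castLE h i))
    (f := (exists_isSmithForm A).choose)
    fun x _ y _ hxy => Fin.castLE_injective h (Fin.rev_injective hxy)]
  exact Finset.prod_dvd_prod_of_subset _ _ _ (Finset.subset_univ _)

/-! ### The expected under-approximation -/

/-- In terms of the determinants of the compressions divided by `μ = μ_k(M)`, the
under-approximation is the greatest common divisor of two of them and `π_k(A)`. -/
theorem underApproximation_eq {n k : ℕ} (A M : Matrix (Fin n) (Fin n) ℤ)
    (B₁ B₂ : Matrix (Fin n) (Fin k) ℤ) (R₁ R₂ : Matrix (Fin k) (Fin n) ℤ) {μ : ℕ} {F₁ F₂ : ℤ}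
    (hμ : μ * largeInvariantProduct k A = invariantFactor A n ^ k) (hN : invariantFactor A n ≠ 0)
    (h₁ : μ * F₁ = (R₁ * M * B₁).det) (h₂ : μ * F₂ = (R₂ * M * B₂).det) :
    underApproximation A M B₁ B₂ R₁ R₂ =
      ((Int.gcd F₁ F₂).gcd (largeInvariantProduct k A) : ℕ) := by
  rw [underApproximation, smallInvariantProduct_self, smallInvariantProduct_self, ← h₁, ← h₂,
    Int.natAbs_mul, Int.natAbs_mul, Int.natAbs_natCast, Nat.gcd_mul_left, ← hμ, Nat.gcd_mul_left,
    Int.gcd_eq_natAbs_gcd_natAbs]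
  have h3 : ((invariantFactor A n : ℝ)) ^ k = μ * largeInvariantProduct k A := by exact_mod_cast hμ.symm
  have h4 : ((invariantFactor A n : ℝ)) ^ k ≠ 0 := pow_ne_zero _ (by exact_mod_cast hN)
  rw [h3] at h4 ⊢
  push_cast
  have h5 := left_ne_zero_of_mul h4
  have h6 := right_ne_zero_of_mul h4
  field_simp

theorem mainTheorem4 :
    ∃ C₁ C₂ : ℝ, ∀ (n k : ℕ) (A : Matrix (Fin n) (Fin n) ℤ) (a : ℤ) (S : ℕ),
      2 ≤ k → k ≤ n → A.det ≠ 0 → 1 ≤ S →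
      ∃ M : Matrix (Fin n) (Fin n) ℤ,
        M.map (Int.cast : ℤ → ℚ) =
          (invariantFactor A n : ℚ) • (A.map (Int.cast : ℤ → ℚ))⁻¹ ∧
        |expectedLogUnderApproximation k A M a S| ≤
          C₁ + C₂ * ((k : ℝ) ^ 3 * Real.log (hadamardBound A) ^ 4 / S) := by
  obtain ⟨C, hC⟩ := exists_expect_logGcd_gcd_le
  -- `384 = 2 * 192`, from `log π_k(A) ≤ 2 * log H`; the maximum with `0` serves small `S`.
  refine ⟨max C 0, 384, ?_⟩
  intro n k A a S hk hkn hA hS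
  obtain ⟨U, V, d, hU, hV, hd, hdmul, hM⟩ := exists_inverse_smithForm (by omega) A hA
  set M := U * Matrix.diagonal (fun i => (d i : ℤ)) * V with hMdef
  refine ⟨M, hM, ?_⟩
  set N := largeInvariantProduct k A with hN
  set μ := ∏ i, d (Fin.castLE hkn i) with hμ
  have hμN : μ * N = invariantFactor A n ^ k := by
    rw [hN, hμ, largeInvariantProduct_eq hkn, ← Finset.prod_mul_distrib]
    simp [hdmul]
  have hdet0 : A.det.natAbs ≠ 0 := Int.natAbs_ne_zero.2 hA
  have hNdvd := largeInvariantProduct_dvd_natAbs_det hkn A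
  have hN0 : N ≠ 0 := ne_zero_of_dvd_ne_zero hdet0 hNdvd
  have hs0 : invariantFactor A n ≠ 0 := by
    have h1 := largeInvariantProduct_dvd_natAbs_det (k := 1) (by omega) A
    have h2 : largeInvariantProduct 1 A = invariantFactor A n := by
      rw [largeInvariantProduct, Nat.sub_add_cancel (by omega), Finset.Icc_self,
        Finset.prod_singleton]
    exact h2 ▸ ne_zero_of_dvd_ne_zero hdet0 h1
  have hμ0 : μ ≠ 0 := fun h0 => by
    rw [h0, zero_mul] at hμN
    exact pow_ne_zero _ hs0 hμN.symm
  have hex : ∀ (R : Matrix (Fin k) (Fin n) ℤ) (B : Matrix (Fin n) (Fin k) ℤ),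
      ∃ F : ℤ, (μ : ℤ) * F = (R * M * B).det := by
    intro R B
    have h1 : R * M * B = R * U * Matrix.diagonal (fun i => (d i : ℤ)) * (V * B) := by
      simp only [hMdef, Matrix.mul_assoc]
    obtain ⟨F, hF⟩ := Matrix.prod_castLE_dvd_det_mul_diagonal_mul hkn d hd (R * U) (V * B)
    exact ⟨F, by rw [h1, hF]⟩
  choose F hF using hex
  have hE : expectedLogUnderApproximation k A M a S =
      (contiguousMatrices n k a S).expect fun B₁ => (contiguousMatrices n k a S).expect fun B₂ =>
      (contiguousMatrices k n a S).expect fun R₁ => (contiguousMatrices k n a S).expect fun R₂ =>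
        logGcd (Int.gcd (F R₁ B₁) (F R₂ B₂)) N := by
    simp only [expectedLogUnderApproximation, logGcd, Int.natAbs_natCast]
    simp only [underApproximation_eq A M _ _ _ _ hμN hs0 (hF _ _) (hF _ _), ← hN]
  have hE0 : 0 ≤ expectedLogUnderApproximation k A M a S := by
    rw [hE]
    exact Finset.expect_nonneg fun _ _ => Finset.expect_nonneg fun _ _ =>
      Finset.expect_nonneg fun _ _ => Finset.expect_nonneg fun _ _ => logGcd_nonneg _ _
  rw [abs_of_nonneg hE0]
  have hNpos : (0 : ℝ) < N := by exact_mod_cast Nat.pos_of_ne_zero hN0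
  set L := Real.log (hadamardBound A) with hL
  have hlogN : Real.log N ≤ 2 * L := by
    have h1 : (N : ℝ) ≤ hadamardBound A ^ 2 :=
      (Nat.cast_le.2 (Nat.le_of_dvd (Nat.pos_of_ne_zero hdet0) hNdvd)).trans
        (natAbs_det_le_hadamardBound_sq A hA)
    have h2 := Real.log_le_log hNpos h1
    rwa [Real.log_pow, Nat.cast_ofNat] at h2
  have hL2 : Real.log 2 ≤ L := by
    refine log_two_le_log_hadamardBound (hk.trans hkn) A fun h0 => hA ?_
    have : Nonempty (Fin n) := ⟨⟨0, by omega⟩⟩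
    rw [h0, Matrix.det_zero]
  have hL0 : 0.6 ≤ L := by have := Real.log_two_gt_d9; linarith
  -- The stated error term dominates `log H / S`.
  have hLk : L ≤ (k : ℝ) ^ 3 * L ^ 4 := by
    have h1 : (8 : ℝ) ≤ (k : ℝ) ^ 3 := by
      have h2 : (2 : ℝ) ≤ k := by exact_mod_cast hk
      calc (8 : ℝ) = 2 ^ 3 := by norm_num
        _ ≤ _ := by gcongr
    have h3 : (0.6 : ℝ) ^ 3 ≤ L ^ 3 := by gcongr
    have h4 : 1 ≤ (k : ℝ) ^ 3 * L ^ 3 := by nlinarith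
    calc L ≤ ((k : ℝ) ^ 3 * L ^ 3) * L := le_mul_of_one_le_left (by linarith) h4
      _ = _ := by ring
  have hS0 : (0 : ℝ) < S := by exact_mod_cast hS
  have herr : L / S ≤ (k : ℝ) ^ 3 * L ^ 4 / S := by gcongr
  by_cases hS4 : 4 ≤ S
  · have h1 := hC hkn U V hU hV d hμ0 F hF hN0 a hS4
    rw [← hE] at h1
    have h2 : Real.log N / S ≤ 2 * L / S := by gcongr
    have h3 : 2 * L / S = 2 * (L / S) := by ring
    have h4 := le_max_left C 0
    linarith
  · -- For bounded `S` the trivial bound `log π_k(A)` suffices.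
    have hS3 : (S : ℝ) ≤ 4 := by exact_mod_cast (by omega : S ≤ 4)
    have h1 : expectedLogUnderApproximation k A M a S ≤ Real.log N := by
      rw [hE]
      have hne : ∀ m l, (contiguousMatrices m l a S).Nonempty := fun m l =>
        contiguousMatrices_nonempty m l a (by omega)
      refine Finset.expect_le (hne _ _) fun _ _ => Finset.expect_le (hne _ _) fun _ _ =>
        Finset.expect_le (hne _ _) fun _ _ => Finset.expect_le (hne _ _) fun _ _ => ?_
      refine Real.log_le_log ?_ ?_
      · exact_mod_cast Nat.gcd_pos_of_pos_right _ (Nat.pos_of_ne_zero hN0)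
      · exact_mod_cast Nat.gcd_le_right _ (Nat.pos_of_ne_zero hN0)
    have h2 : L ≤ 4 * (L / S) := by
      rw [← mul_div_assoc, le_div_iff₀ hS0]
      nlinarith
    have h3 := le_max_right C 0
    have h4 : 0 ≤ L / S := by positivity
    linarith
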